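/- Let $\mathbb T^2=\mathbb R^2/\mathbb Z^2$ with coordinates $(q,p)$. For a positive integer $N$ let $\mathcal H_N\cong\mathbb C^N$ carry its standard Hermitian inner product and its position basis $\mathbf q_0,\dots,\mathbf q_{N-1}$ (indices read modulo $N$). For $k=(k_1,k_2)\in\mathbb Z^2$ let $T(k)$ be the quantum translation on $\mathcal H_N$, $$T(k)\,\mathbf q_j=e^{-\pi i k_1k_2/N}\,e^{2\pi i k_2(j+k_1)/N}\,\mathbf q_{j+k_1},$$ and for $a\in C^\infty(\mathbb T^2)$ with Fourier expansion $a(q,p)=\sum_{k\in\mathbb Z^2}\tilde a(k)\,e^{2\pi i(qk_2-pk_1)}$ let $\mathrm{Op}^{\rm W}_N(a)=\sum_{k\in\mathbb Z^2}\tilde a(k)\,T(k)$ be its Weyl quantisation. For $N$ even, the Balazs–Voros quantised baker's map is the unitary matrix $$\hat B_N=\hat F_N^{-1}\begin{pmatrix}\hat F_{N/2}&0\\0&\hat F_{N/2}\end{pmatrix},\qquad (\hat F_M)_{kj}=\frac1{\sqrt M}\,e^{-2\pi i kj/M}\quad(0\le k,j<M).$$ For an orthonormal basis $\varphi=(\varphi_{N,j})_{0\le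 j<N}$ of $\mathcal H_N$ consisting of eigenvectors of $\hat B_N$, the quantum variance is $$S_2(a,N)=\frac1N\sum_{j=0}^{N-1}\Big|\langle\varphi_{N,j},\mathrm{Op}^{\rm W}_N(a)\,\varphi_{N,j}\rangle-\int_{\mathbb T^2}a\,dq\,dp\Big|^2 .$$ **Theorem.** For every (complex-valued) $a\in C^\infty(\mathbb T^2)$ the series defining $\mathrm{Op}^{\rm W}_N(a)$ converges absolutely for every $N$, and there is a constant $C(a)$, depending only on $a$, such that for every even positive integer $N$ and every orthonormal eigenbasis of $\hat B_N$, $$S_2(a,N)\le\frac{C(a)}{\log N}.$$ -/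

import Mathlib

open scoped ContDiff

noncomputable section

namespace BakerMap

/-- The state space `H_N`, in the canonical position basis `q_0, …, q_{N-1}`: the vector `ψ` stands
for the periodic distribution `N^{-1/2} ∑_{j ∈ ℤ} ψ_{j mod N} δ(q - j/N)`. -/
abbrev StateSpace (N : ℕ) : Type := EuclideanSpace ℂ (Fin N)

/-- The operator on `H_N` with a given matrix in the position basis. -/
abbrev op {N : ℕ} (A : Matrix (Fin N) (Fin N) ℂ) : StateSpace N →ₗ[ℂ] StateSpace N :=
  Matrix.toEuclideanLin A

/-- The entry `N^{-1/2} e^{-2πi kj/N}` of the discrete Fourier transform. -/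
def dftEntry (N k j : ℕ) : ℂ :=
  (1 / (Real.sqrt N : ℂ)) * Complex.exp (-2 * Real.pi * Complex.I * k * j / N)

/-- The discrete Fourier transform `F_N`, an `N × N` matrix. -/
def dft (N : ℕ) : Matrix (Fin N) (Fin N) ℂ :=
  Matrix.of fun k j => dftEntry N k j

/-- The block diagonal matrix `diag (F_{N/2}, F_{N/2})` (for even `N`). -/
def bakerMix (N : ℕ) : Matrix (Fin N) (Fin N) ℂ :=
  Matrix.of fun k j =>
    if (k : ℕ) < N / 2 ∧ (j : ℕ) < N / 2 then dftEntry (N / 2) k j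
    else if N / 2 ≤ (k : ℕ) ∧ N / 2 ≤ (j : ℕ) then dftEntry (N / 2) ((k : ℕ) - N / 2) ((j : ℕ) - N / 2)
    else 0

/-- The Balazs–Voros quantised baker's map `B_N = F_N⁻¹ diag (F_{N/2}, F_{N/2})` (for even `N`). -/
def quantumBaker (N : ℕ) : Matrix (Fin N) (Fin N) ℂ :=
  (dft N)⁻¹ * bakerMix N

/-- The matrix on `H_N` of the quantum translation `T(k) = e^{2πi (k₂ q̂ - k₁ p̂)}`, where
`q̂` is multiplication by `q` and `p̂ = (2πi N)⁻¹ d/dq`. As an operator on distributions,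
`(T(k) ψ)(q) = e^{-πi k₁ k₂ / N} e^{2πi k₂ q} ψ(q - k₁/N)`, so that on coefficients
`(T(k) ψ)_i = e^{-πi k₁ k₂ / N} e^{2πi k₂ i / N} ψ_{i - k₁ mod N}`. -/
def translation (N : ℕ) (k : ℤ × ℤ) : Matrix (Fin N) (Fin N) ℂ :=
  Matrix.of fun i j =>
    if ((i : ℕ) : ℤ) ≡ ((j : ℕ) : ℤ) + k.1 [ZMOD (N : ℤ)] then
      Complex.exp (-(Real.pi * Complex.I * k.1 * k.2 / N)) *
        Complex.exp (2 * Real.pi * Complex.I * k.2 * (i : ℕ) / N)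
    else 0

/-- `a : ℝ² → ℂ`, in the variables `(q, p)`, is a smooth function on the torus `ℝ²/ℤ²`. -/
structure IsSmoothObservable (a : ℝ × ℝ → ℂ) : Prop where
  contDiff : ContDiff ℝ ∞ a
  periodic_q : ∀ q p : ℝ, a (q + 1, p) = a (q, p)
  periodic_p : ∀ q p : ℝ, a (q, p + 1) = a (q, p)

/-- The mean of `a` over the torus. -/
def torusMean (a : ℝ × ℝ → ℂ) : ℂ :=
  ∫ q in (0 : ℝ)..1, ∫ p in (0 : ℝ)..1, a (q, p)

/-- The Fourier coefficient of `a` along `e_k(q, p) = e^{2πi (q k₂ - p k₁)}`. -/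
def fourierCoefficient (a : ℝ × ℝ → ℂ) (k : ℤ × ℤ) : ℂ :=
  torusMean fun x =>
    a x * Complex.exp (-(2 * Real.pi * Complex.I * (x.1 * k.2 - x.2 * k.1)))

/-- The Weyl quantisation `∑_{k ∈ ℤ²} ã(k) T(k)`, as a matrix in the position basis. -/
def weyl (N : ℕ) (a : ℝ × ℝ → ℂ) : Matrix (Fin N) (Fin N) ℂ :=
  ∑' k : ℤ × ℤ, fourierCoefficient a k • translation N k

/-- `φ` is an orthonormal basis of `H_N` that consists of eigenvectors of `B_N`. -/
def IsBakerEigenbasis {N : ℕ} (φ : OrthonormalBasis (Fin N) ℂ (StateSpace N)) : Prop :=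
  ∀ j, ∃ μ : ℂ, op (quantumBaker N) (φ j) = μ • φ j

/-- The quantum variance `S₂(a, N)` over the orthonormal basis `φ`. -/
def quantumVariance {N : ℕ} (φ : OrthonormalBasis (Fin N) ℂ (StateSpace N))
    (a : ℝ × ℝ → ℂ) : ℝ :=
  (1 / (N : ℝ)) * ∑ j : Fin N, ‖inner ℂ (φ j) (op (weyl N a) (φ j)) - torusMean a‖ ^ 2

end BakerMap

end

/-! An eigenbasis of the baker's map gives the same expectation values to `X` and to `evolve t X`.
The vector of expectation values of `X` is therefore that of a time average of evolutions, and its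
norm is at most the Hilbert–Schmidt norm of this average (`norm_expectVec_le`). When the
autocorrelations `hsInner X (evolve r X)` add up to O(N) over 0 ≤ r ≤ T, the average has squared
norm O(N/T) (`norm_expectVec_sq_le`), so the variance is O(1/T). It remains to prove such decay for
`X = T(k)`, k ≠ 0, with T a small multiple of log N.

The tool is an Egorov theorem in Hilbert–Schmidt norm, which tolerates the discontinuities of the
map. The entries of the matrix decay like the inverse distance to the graph m = 2m' mod N
(`norm_quantumBaker_sq_le`). Hence a function of position of cyclic variation V, possibly an
indicator, is transported with error O(√V N^{1/4}), small against the natural scale √N. Because F K*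
is the entrywise conjugate of the map, the same commutator estimate serves functions of momentum.
One step turns g(p̂) into nearly 1_L g(p̂/2) + 1_R g((p̂+1)/2), with L and R the two halves of the
position interval (`hsNorm_evolve_momentumOp_sub_le`).

Each such step halves the Lipschitz constant, while recombining the two branches costs only √2,
their rows being disjoint. So the evolution of a function of momentum approaches the diagonal
matrices at rate (√2/2)^t (`offNorm_evolve_momentumOp_le`). Now T(k) is a character of position
times a character of momentum. If 0 < |k₁| < N its diagonal vanishes, and correlations only see the
off-diagonal part of its evolution. If k₁ = 0, evolution carries the frequency k₂ to 2^r k₂, which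
is orthogonal to k₂ as long as there is no aliasing mod N. For the remaining large k the trivial
bound suffices, since |k₁| + |k₂| already exceeds T. Rapid decay of the Fourier coefficients sums
the contributions. -/

noncomputable section

namespace BakerMap

open Matrix Finset ComplexConjugate

set_option linter.unusedSectionVars false

/-! ### Hilbert–Schmidt geometry and the distance to diagonal matrices. -/

section HilbertSchmidt

variable {n : Type*} [Fintype n] [DecidableEq n]

/-- The entries of a matrix, as a vector of the Hilbert–Schmidt space. -/
def hsVec : Matrix n n ℂ →ₗ[ℂ] EuclideanSpace ℂ (n × n) where
  toFun A := WithLp.toLp 2 fun x => A x.1 x.2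
  map_add' _ _ := rfl
  map_smul' _ _ := rfl

/-- The Hilbert–Schmidt norm. -/
def hsNorm (A : Matrix n n ℂ) : ℝ := ‖hsVec A‖

/-- The Hilbert–Schmidt inner product. -/
def hsInner (A B : Matrix n n ℂ) : ℂ := inner ℂ (hsVec A) (hsVec B)

lemma hsNorm_sq (A : Matrix n n ℂ) : hsNorm A ^ 2 = ∑ i, ∑ j, ‖A i j‖ ^ 2 := by
  rw [hsNorm, EuclideanSpace.norm_sq_eq, Fintype.sum_prod_type]
  rfl

lemma hsNorm_nonneg (A : Matrix n n ℂ) : 0 ≤ hsNorm A := norm_nonneg _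

lemma hsNorm_add_le (A B : Matrix n n ℂ) : hsNorm (A + B) ≤ hsNorm A + hsNorm B := by
  simpa [hsNorm] using norm_add_le (hsVec A) (hsVec B)

lemma hsNorm_le_of_sq {A : Matrix n n ℂ} {c : ℝ} (hc : 0 ≤ c)
    (h : ∑ i, ∑ j, ‖A i j‖ ^ 2 ≤ c ^ 2) : hsNorm A ≤ c := by
  rw [← hsNorm_sq] at h
  exact (sq_le_sq₀ (hsNorm_nonneg A) hc).1 h

lemma hsInner_eq_trace (A B : Matrix n n ℂ) : hsInner A B = (Aᴴ * B).trace := by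
  simp only [hsInner, PiLp.inner_apply, Matrix.trace, Matrix.diag_apply, Matrix.mul_apply,
    Matrix.conjTranspose_apply, RCLike.inner_apply, Fintype.sum_prod_type]
  rw [Finset.sum_comm]
  simp only [mul_comm, RCLike.star_def]
  rfl

lemma norm_hsInner_le (A B : Matrix n n ℂ) : ‖hsInner A B‖ ≤ hsNorm A * hsNorm B :=
  norm_inner_le_norm _ _

lemma hsNorm_sq_eq_trace (A : Matrix n n ℂ) : ((hsNorm A ^ 2 : ℝ) : ℂ) = (Aᴴ * A).trace := by
  rw [← hsInner_eq_trace, hsInner, inner_self_eq_norm_sq_to_K]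
  simp [hsNorm]

lemma hsInner_unitary {U V : Matrix n n ℂ} (hU : Uᴴ * U = 1) (hV : Vᴴ * V = 1)
    (A B : Matrix n n ℂ) : hsInner (U * A * V) (U * B * V) = hsInner A B := by
  have hV' : V * Vᴴ = 1 := mul_eq_one_comm.1 hV
  rw [hsInner_eq_trace, hsInner_eq_trace]
  have : (U * A * V)ᴴ * (U * B * V) = Vᴴ * (Aᴴ * B * V) := by
    simp only [Matrix.conjTranspose_mul]
    calc Vᴴ * (Aᴴ * Uᴴ) * (U * B * V) = Vᴴ * (Aᴴ * (Uᴴ * U) * B * V) := by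
          simp only [Matrix.mul_assoc]
      _ = _ := by rw [hU, Matrix.mul_one]
  rw [this, Matrix.trace_mul_comm, Matrix.mul_assoc, hV', Matrix.mul_one]

lemma hsNorm_unitary {U V : Matrix n n ℂ} (hU : Uᴴ * U = 1) (hV : Vᴴ * V = 1)
    (A : Matrix n n ℂ) : hsNorm (U * A * V) = hsNorm A := by
  have h := hsInner_unitary hU hV A A
  rw [hsInner_eq_trace, hsInner_eq_trace, ← hsNorm_sq_eq_trace, ← hsNorm_sq_eq_trace] at h
  have h' : hsNorm (U * A * V) ^ 2 = hsNorm A ^ 2 := by exact_mod_cast h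
  exact (sq_eq_sq₀ (hsNorm_nonneg _) (hsNorm_nonneg _)).1 h'

lemma hsNorm_unitary_mul {U : Matrix n n ℂ} (hU : Uᴴ * U = 1) (A : Matrix n n ℂ) :
    hsNorm (U * A) = hsNorm A := by
  simpa using hsNorm_unitary hU (V := 1) (by simp) A

lemma hsNorm_mul_unitary {V : Matrix n n ℂ} (hV : Vᴴ * V = 1) (A : Matrix n n ℂ) :
    hsNorm (A * V) = hsNorm A := by
  simpa using hsNorm_unitary (U := 1) (by simp) hV A

lemma hsNorm_diagonal_mul_le {u : n → ℂ} {c : ℝ} (hc : 0 ≤ c) (hu : ∀ i, ‖u i‖ ≤ c)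
    (A : Matrix n n ℂ) : hsNorm (diagonal u * A) ≤ c * hsNorm A := by
  apply hsNorm_le_of_sq (mul_nonneg hc (hsNorm_nonneg A))
  rw [mul_pow, hsNorm_sq, mul_sum]
  refine sum_le_sum fun i _ => ?_
  rw [mul_sum]
  refine sum_le_sum fun j _ => ?_
  rw [diagonal_mul, norm_mul, mul_pow]
  gcongr
  exact hu i

lemma hsNorm_mul_diagonal_le {u : n → ℂ} {c : ℝ} (hc : 0 ≤ c) (hu : ∀ i, ‖u i‖ ≤ c)
    (A : Matrix n n ℂ) : hsNorm (A * diagonal u) ≤ c * hsNorm A := by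
  apply hsNorm_le_of_sq (mul_nonneg hc (hsNorm_nonneg A))
  rw [mul_pow, hsNorm_sq, mul_sum]
  refine sum_le_sum fun i _ => ?_
  rw [mul_sum]
  refine sum_le_sum fun j _ => ?_
  rw [mul_diagonal, norm_mul, mul_pow, mul_comm]
  gcongr
  exact hu j

lemma hsNorm_diagonal_le {u : n → ℂ} {c : ℝ} (hc : 0 ≤ c) (hu : ∀ i, ‖u i‖ ≤ c) :
    hsNorm (diagonal u) ≤ c * Real.sqrt (Fintype.card n) := by
  have h1 : hsNorm (1 : Matrix n n ℂ) ≤ Real.sqrt (Fintype.card n) := by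
    apply hsNorm_le_of_sq (Real.sqrt_nonneg _)
    rw [Real.sq_sqrt (Nat.cast_nonneg _)]
    simp [Matrix.one_apply, apply_ite]
  calc hsNorm (diagonal u) = hsNorm (diagonal u * 1) := by rw [Matrix.mul_one]
    _ ≤ c * hsNorm 1 := hsNorm_diagonal_mul_le hc hu 1
    _ ≤ _ := by gcongr

/-- The off-diagonal part of a matrix. -/
def offDiag (A : Matrix n n ℂ) : Matrix n n ℂ := A - diagonal A.diag

/-- The Hilbert–Schmidt distance from a matrix to the diagonal matrices. -/
def offNorm (A : Matrix n n ℂ) : ℝ := hsNorm (offDiag A)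

lemma offDiag_apply (A : Matrix n n ℂ) (i j : n) :
    offDiag A i j = if i = j then 0 else A i j := by
  by_cases h : i = j
  · subst h; simp [offDiag]
  · simp [offDiag, h]

lemma offNorm_nonneg (A : Matrix n n ℂ) : 0 ≤ offNorm A := hsNorm_nonneg _

lemma offNorm_add_le (A B : Matrix n n ℂ) : offNorm (A + B) ≤ offNorm A + offNorm B := by
  have : offDiag (A + B) = offDiag A + offDiag B := by
    ext i j; simp only [offDiag_apply, Matrix.add_apply]; split_ifs <;> simp
  rw [offNorm, this]
  exact hsNorm_add_le _ _

lemma offNorm_le_hsNorm (A : Matrix n n ℂ) : offNorm A ≤ hsNorm A := by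
  apply hsNorm_le_of_sq (hsNorm_nonneg A)
  rw [hsNorm_sq]
  refine sum_le_sum fun i _ => sum_le_sum fun j _ => ?_
  rw [offDiag_apply]
  split_ifs
  · simp
  · exact le_rfl

lemma offNorm_le_add (A B : Matrix n n ℂ) : offNorm A ≤ offNorm B + hsNorm (A - B) := by
  calc offNorm A = offNorm (B + (A - B)) := by rw [add_sub_cancel]
    _ ≤ _ := (offNorm_add_le _ _).trans (by gcongr; exact offNorm_le_hsNorm _)

lemma offNorm_diagonal (u : n → ℂ) : offNorm (diagonal u) = 0 := by
  have : offDiag (diagonal u) = 0 := by simp [offDiag]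
  simp [offNorm, this, hsNorm]

lemma offNorm_diagonal_mul_le {u : n → ℂ} {c : ℝ} (hc : 0 ≤ c) (hu : ∀ i, ‖u i‖ ≤ c)
    (A : Matrix n n ℂ) : offNorm (diagonal u * A) ≤ c * offNorm A := by
  have : offDiag (diagonal u * A) = diagonal u * offDiag A := by
    ext i j; simp only [offDiag_apply, diagonal_mul]; split_ifs <;> simp
  rw [offNorm, this]
  exact hsNorm_diagonal_mul_le hc hu _

open Classical in
/-- The `0`-`1` valued function of a predicate. -/
def indic (s : n → Prop) (i : n) : ℂ := if s i then 1 else 0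

lemma norm_indic_le (s : n → Prop) (i : n) : ‖indic s i‖ ≤ 1 := by
  unfold indic; split_ifs <;> simp

lemma indic_not (s : n → Prop) (i : n) : indic (fun i => ¬ s i) i = 1 - indic s i := by
  unfold indic
  by_cases h : s i <;> simp [h]

lemma star_indic (s : n → Prop) : star (indic s) = indic s := by
  funext i
  rw [Pi.star_apply]
  unfold indic
  split_ifs <;> simp

/-- The two summands live on disjoint rows, so squares of norms add. The constant √2 instead of 2 is
what leaves a contraction once Lipschitz constants are halved. -/
lemma offNorm_indic_add_le (s : n → Prop) (A B : Matrix n n ℂ) {c : ℝ}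
    (hA : offNorm A ≤ c) (hB : offNorm B ≤ c) :
    offNorm (diagonal (indic s) * A + diagonal (indic fun i => ¬ s i) * B) ≤ Real.sqrt 2 * c := by
  have hc : 0 ≤ c := (offNorm_nonneg A).trans hA
  apply hsNorm_le_of_sq (by positivity)
  have hA2 : offNorm A ^ 2 ≤ c ^ 2 := by gcongr; exact offNorm_nonneg A
  have hB2 : offNorm B ^ 2 ≤ c ^ 2 := by gcongr; exact offNorm_nonneg B
  calc _ ≤ offNorm A ^ 2 + offNorm B ^ 2 := by
        rw [offNorm, offNorm, hsNorm_sq, hsNorm_sq, ← sum_add_distrib]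
        refine sum_le_sum fun i _ => ?_
        rw [← sum_add_distrib]
        refine sum_le_sum fun j _ => ?_
        simp only [offDiag_apply, Matrix.add_apply, diagonal_mul, indic]
        split_ifs <;> simp
    _ ≤ _ := by rw [mul_pow, Real.sq_sqrt (by norm_num)]; linarith

/-- A matrix with vanishing diagonal only sees the off-diagonal part of another. -/
lemma norm_hsInner_le_offNorm {A : Matrix n n ℂ} (hA : ∀ i, A i i = 0) (B : Matrix n n ℂ) :
    ‖hsInner A B‖ ≤ hsNorm A * offNorm B := by
  have : hsInner A B = hsInner A (offDiag B) := by
    rw [hsInner_eq_trace, hsInner_eq_trace]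
    simp only [Matrix.trace, Matrix.diag_apply, Matrix.mul_apply, Matrix.conjTranspose_apply,
      offDiag_apply]
    refine sum_congr rfl fun i _ => sum_congr rfl fun j _ => ?_
    split_ifs with h
    · subst h; simp [hA]
    · rfl
  rw [this]
  exact norm_hsInner_le _ _

end HilbertSchmidt

/-! ### Characters of the circle and exponential sums. -/

/-- The character `x ↦ e^{2πi x}`. -/
def circ (x : ℝ) : ℂ := Complex.exp (2 * Real.pi * Complex.I * x)

lemma circ_zero : circ 0 = 1 := by simp [circ]

lemma circ_add (x y : ℝ) : circ (x + y) = circ x * circ y := by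
  rw [circ, circ, circ, ← Complex.exp_add]; push_cast; ring_nf

lemma norm_circ (x : ℝ) : ‖circ x‖ = 1 := by
  have : (2 * Real.pi * Complex.I * x : ℂ) = ((2 * Real.pi * x : ℝ) : ℂ) * Complex.I := by
    push_cast; ring
  rw [circ, this, Complex.norm_exp_ofReal_mul_I]

lemma conj_circ (x : ℝ) : conj (circ x) = circ (-x) := by
  rw [circ, circ, ← Complex.exp_conj]
  simp only [map_mul, Complex.conj_ofReal, Complex.conj_I, map_ofNat, Complex.ofReal_neg]
  ring_nf

lemma circ_intCast (k : ℤ) : circ k = 1 := by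
  rw [circ]
  have : (2 * Real.pi * Complex.I * ((k : ℝ) : ℂ) : ℂ) = k * (2 * Real.pi * Complex.I) := by
    push_cast; ring
  rw [this, Complex.exp_int_mul_two_pi_mul_I]

lemma circ_add_intCast (x : ℝ) (k : ℤ) : circ (x + k) = circ x := by
  rw [circ_add, circ_intCast, mul_one]

lemma circ_natCast_mul (n : ℕ) (x : ℝ) : circ (n * x) = circ x ^ n := by
  rw [circ, circ, ← Complex.exp_nat_mul]; push_cast; ring_nf

lemma circ_eq_one_iff (x : ℝ) : circ x = 1 ↔ ∃ k : ℤ, x = k := by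
  constructor
  · intro h
    obtain ⟨k, hk⟩ := Complex.exp_eq_one_iff.1 h
    refine ⟨k, ?_⟩
    have h0 : (2 * Real.pi * Complex.I : ℂ) ≠ 0 := Complex.two_pi_I_ne_zero
    have : (x : ℂ) = k := by
      apply mul_left_cancel₀ h0
      rw [hk]; ring
    exact_mod_cast this
  · rintro ⟨k, rfl⟩; exact circ_intCast k

lemma norm_circ_sub_one (x : ℝ) : ‖circ x - 1‖ = 2 * |Real.sin (Real.pi * x)| := by
  have h : circ x = Complex.exp (Complex.I * ((2 * Real.pi * x : ℝ) : ℂ)) := by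
    rw [circ]; push_cast; ring_nf
  rw [h, Complex.norm_exp_I_mul_ofReal_sub_one, norm_mul]
  simp only [Real.norm_eq_abs, abs_two]
  congr 3; ring

lemma norm_circ_sub_le (x y : ℝ) : ‖circ x - circ y‖ ≤ 2 * Real.pi * |x - y| := by
  have h : circ x - circ y = circ y * (circ (x - y) - 1) := by
    rw [mul_sub, ← circ_add, mul_one]; ring_nf
  rw [h, norm_mul, norm_circ, one_mul, norm_circ_sub_one]
  have := Real.abs_sin_le_abs (x := Real.pi * (x - y))
  rw [abs_mul, abs_of_pos Real.pi_pos] at this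
  linarith

/-- Jordan's inequality sin(πy) ≥ 2y on [0, 1/2], reflected about 1/2. -/
lemma le_norm_circ_sub_one {x : ℝ} (h0 : 0 ≤ x) (h1 : x ≤ 1) :
    4 * min x (1 - x) ≤ ‖circ x - 1‖ := by
  have key : ∀ y : ℝ, 0 ≤ y → y ≤ 1 / 2 → 2 * y ≤ Real.sin (Real.pi * y) := by
    intro y hy hy'
    have := Real.mul_le_sin (x := Real.pi * y) (by positivity) (by nlinarith [Real.pi_pos])
    have hpi := Real.pi_ne_zero
    have h2 : 2 / Real.pi * (Real.pi * y) = 2 * y := by field_simp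
    linarith
  rw [norm_circ_sub_one]
  rcases le_total x (1 / 2) with h | h
  · have := key x h0 h
    have h2 := le_abs_self (Real.sin (Real.pi * x))
    have h3 := min_le_left x (1 - x)
    linarith
  · have := key (1 - x) (by linarith) (by linarith)
    rw [show Real.pi * (1 - x) = Real.pi - Real.pi * x by ring, Real.sin_pi_sub] at this
    have h2 := le_abs_self (Real.sin (Real.pi * x))
    have h3 := min_le_right x (1 - x)
    linarith

lemma sum_circ (N : ℕ) (hN : 0 < N) (c : ℤ) :
    ∑ m : Fin N, circ ((m : ℕ) * (c / N)) = if (N : ℤ) ∣ c then (N : ℂ) else 0 := by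
  have hN' : (N : ℝ) ≠ 0 := by positivity
  have hz : circ (c / N) = 1 ↔ (N : ℤ) ∣ c := by
    rw [circ_eq_one_iff]
    constructor
    · rintro ⟨k, hk⟩
      rw [div_eq_iff hN'] at hk
      exact ⟨k, by rw [mul_comm]; exact_mod_cast hk⟩
    · rintro ⟨k, rfl⟩
      exact ⟨k, by push_cast; field_simp⟩
  simp only [circ_natCast_mul]
  rw [Fin.sum_univ_eq_sum_range (fun m => circ (c / N) ^ m)]
  split_ifs with h
  · rw [hz.2 h]; simp
  · rw [geom_sum_eq (fun h' => h (hz.1 h')), ← circ_natCast_mul, mul_div_cancel₀ _ hN',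
      circ_intCast]
    simp

/-! ### The Fourier matrices, the baker's map and the decay of its entries. -/

lemma dftEntry_eq (N k j : ℕ) :
    dftEntry N k j = (1 / (Real.sqrt N : ℂ)) * circ (-((k : ℝ) * (j / N))) := by
  rw [dftEntry, circ]
  congr 2
  push_cast; ring

lemma dft_apply (N : ℕ) (k j : Fin N) :
    dft N k j = (1 / (Real.sqrt N : ℂ)) * circ (-(((k : ℕ) : ℝ) * ((j : ℕ) / N))) := by
  rw [dft, Matrix.of_apply, dftEntry_eq]

lemma inv_sqrt_mul_self (N : ℕ) :
    (1 / (Real.sqrt N : ℂ)) * (1 / (Real.sqrt N : ℂ)) = 1 / N := by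
  rw [div_mul_div_comm, one_mul, ← Complex.ofReal_mul, Real.mul_self_sqrt (Nat.cast_nonneg N)]
  simp

lemma conj_inv_sqrt (N : ℕ) : conj (1 / (Real.sqrt N : ℂ)) = 1 / (Real.sqrt N : ℂ) := by
  simp

/-- A multiplication operator in the momentum basis, as a matrix in the position basis. -/
lemma dft_conj_diagonal_apply (N : ℕ) (u : Fin N → ℂ) (i j : Fin N) :
    ((dft N)ᴴ * diagonal u * dft N) i j =
      1 / N * ∑ m : Fin N, u m * circ ((m : ℕ) * ((((i : ℕ) : ℝ) - (j : ℕ)) / N)) := by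
  rw [Matrix.mul_apply, mul_sum]
  refine sum_congr rfl fun m _ => ?_
  rw [Matrix.mul_diagonal, Matrix.conjTranspose_apply, dft_apply, dft_apply, RCLike.star_def,
    map_mul, conj_inv_sqrt, conj_circ]
  rw [show ((m : ℕ) : ℝ) * ((((i : ℕ) : ℝ) - (j : ℕ)) / N)
    = - -(((m : ℕ) : ℝ) * ((i : ℕ) / N)) + -(((m : ℕ) : ℝ) * ((j : ℕ) / N)) by ring, circ_add]
  linear_combination (u m * circ (- -(((m : ℕ) : ℝ) * ((i : ℕ) / N))) *
    circ (-(((m : ℕ) : ℝ) * ((j : ℕ) / N)))) * inv_sqrt_mul_self N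

lemma dft_unitary {N : ℕ} (hN : 0 < N) : (dft N)ᴴ * dft N = 1 := by
  ext i j
  have h := dft_conj_diagonal_apply N (fun _ => 1) i j
  rw [Matrix.diagonal_one, Matrix.mul_one] at h
  rw [h]
  simp only [one_mul]
  have := sum_circ N hN ((i : ℕ) - (j : ℕ) : ℤ)
  push_cast at this
  rw [this, Matrix.one_apply]
  have hN' : (N : ℂ) ≠ 0 := by exact_mod_cast hN.ne'
  have hiff : ((N : ℤ) ∣ ((i : ℕ) - (j : ℕ) : ℤ)) ↔ i = j := by
    constructor
    · intro hd
      have := Int.eq_zero_of_abs_lt_dvd hd (by rw [abs_lt]; omega)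
      ext; omega
    · rintro rfl; simp
  simp only [hiff]
  split_ifs
  · field_simp
  · simp

lemma dft_symm (N : ℕ) : (dft N)ᵀ = dft N := by
  ext i j
  rw [Matrix.transpose_apply, dft_apply, dft_apply]
  congr 2; ring

lemma dft_inv {N : ℕ} (hN : 0 < N) : (dft N)⁻¹ = (dft N)ᴴ :=
  Matrix.inv_eq_left_inv (dft_unitary hN)

lemma bakerMix_left_left {M : ℕ} (i j : Fin M) :
    bakerMix (M + M) (Fin.castAdd M i) (Fin.castAdd M j) = dft M i j := by
  simp only [bakerMix, dft, Matrix.of_apply, Fin.val_castAdd]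
  have h : (M + M) / 2 = M := by omega
  rw [if_pos (by omega), h]

lemma bakerMix_left_right {M : ℕ} (i j : Fin M) :
    bakerMix (M + M) (Fin.castAdd M i) (Fin.natAdd M j) = 0 := by
  simp only [bakerMix, Matrix.of_apply, Fin.val_castAdd, Fin.val_natAdd]
  rw [if_neg (by omega), if_neg (by omega)]

lemma bakerMix_right_left {M : ℕ} (i j : Fin M) :
    bakerMix (M + M) (Fin.natAdd M i) (Fin.castAdd M j) = 0 := by
  simp only [bakerMix, Matrix.of_apply, Fin.val_castAdd, Fin.val_natAdd]
  rw [if_neg (by omega), if_neg (by omega)]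

lemma bakerMix_right_right {M : ℕ} (i j : Fin M) :
    bakerMix (M + M) (Fin.natAdd M i) (Fin.natAdd M j) = dft M i j := by
  simp only [bakerMix, dft, Matrix.of_apply, Fin.val_natAdd]
  have h : (M + M) / 2 = M := by omega
  rw [if_neg (by omega), if_pos (by omega), h, Nat.add_sub_cancel_left, Nat.add_sub_cancel_left]

lemma bakerMix_eq (M : ℕ) : bakerMix (M + M) =
    (fromBlocks (dft M) 0 0 (dft M)).submatrix finSumFinEquiv.symm finSumFinEquiv.symm := by
  ext i j
  obtain ⟨i, rfl⟩ := finSumFinEquiv.surjective i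
  obtain ⟨j, rfl⟩ := finSumFinEquiv.surjective j
  rw [Matrix.submatrix_apply, Equiv.symm_apply_apply, Equiv.symm_apply_apply]
  rcases i with i | i <;> rcases j with j | j <;>
    simp only [finSumFinEquiv_apply_left, finSumFinEquiv_apply_right, bakerMix_left_left,
      bakerMix_left_right, bakerMix_right_left, bakerMix_right_right, fromBlocks_apply₁₁,
      fromBlocks_apply₁₂, fromBlocks_apply₂₁, fromBlocks_apply₂₂, Matrix.zero_apply]

lemma bakerMix_unitary {M : ℕ} (hM : 0 < M) : (bakerMix (M + M))ᴴ * bakerMix (M + M) = 1 := by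
  rw [bakerMix_eq, Matrix.conjTranspose_submatrix, Matrix.submatrix_mul_equiv,
    Matrix.fromBlocks_conjTranspose, Matrix.fromBlocks_multiply]
  simp [dft_unitary hM]

lemma bakerMix_symm (M : ℕ) : (bakerMix (M + M))ᵀ = bakerMix (M + M) := by
  rw [bakerMix_eq, Matrix.transpose_submatrix, Matrix.fromBlocks_transpose, dft_symm]
  simp

lemma quantumBaker_eq {N : ℕ} (hN : 0 < N) : quantumBaker N = (dft N)ᴴ * bakerMix N := by
  rw [quantumBaker, dft_inv hN]

lemma quantumBaker_unitary {M : ℕ} (hM : 0 < M) :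
    (quantumBaker (M + M))ᴴ * quantumBaker (M + M) = 1 := by
  have hF : dft (M + M) * (dft (M + M))ᴴ = 1 := mul_eq_one_comm.1 (dft_unitary (by omega))
  rw [quantumBaker_eq (by omega), Matrix.conjTranspose_mul, Matrix.conjTranspose_conjTranspose]
  rw [Matrix.mul_assoc, ← Matrix.mul_assoc (dft (M + M)), hF, Matrix.one_mul, bakerMix_unitary hM]

/-- `F K*` is the complex conjugate of the quantised baker's map `F* K`. -/
lemma dft_mul_bakerMix_conjTranspose {M : ℕ} (hM : 0 < M) (i j : Fin (M + M)) :
    (dft (M + M) * (bakerMix (M + M))ᴴ) i j = conj (quantumBaker (M + M) i j) := by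
  rw [quantumBaker_eq (by omega), Matrix.mul_apply, Matrix.mul_apply, map_sum]
  refine sum_congr rfl fun k _ => ?_
  rw [map_mul, Matrix.conjTranspose_apply, Matrix.conjTranspose_apply]
  simp only [RCLike.star_def, Complex.conj_conj]
  congr 1
  · exact congrFun (congrFun (dft_symm (M + M)) k) i
  · exact congrArg conj (congrFun (congrFun (bakerMix_symm M) k) j)

/-- The geometric sum telescopes. The product form stays valid when x is an integer. -/
lemma norm_sum_circ_mul_le (M : ℕ) (x : ℝ) :
    ‖∑ j : Fin M, circ ((j : ℕ) * x)‖ * ‖circ x - 1‖ ≤ 2 := by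
  simp only [circ_natCast_mul]
  rw [Fin.sum_univ_eq_sum_range (fun m => circ x ^ m), ← norm_mul, geom_sum_mul]
  refine (norm_sub_le _ _).trans ?_
  rw [norm_pow, norm_circ]
  norm_num

/-- The entries of the quantised baker's map concentrate on the graph of the doubling map. -/
lemma norm_quantumBaker_mul_le {M : ℕ} (hM : 0 < M) (m m' : Fin (M + M)) :
    ‖quantumBaker (M + M) m m'‖ * ‖circ ((((m : ℕ) : ℝ) - 2 * (m' : ℕ)) / ((M + M : ℕ) : ℝ)) - 1‖ ≤
      2 * (1 / Real.sqrt ((M + M : ℕ) : ℝ) * (1 / Real.sqrt M)) := by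
  have hM' : (M : ℝ) ≠ 0 := by exact_mod_cast hM.ne'
  -- The offset d is 0 for a column in the left half and M for one in the right half; it only
  -- contributes a phase.
  have key : ∀ (l : Fin M) (d : ℕ) (hd : ∀ j : Fin M, d + j < M + M),
      ‖∑ j : Fin M, conj (dft (M + M) ⟨d + j, hd j⟩ m) * dft M j l‖ *
        ‖circ ((((m : ℕ) : ℝ) - 2 * (l : ℕ)) / ((M + M : ℕ) : ℝ)) - 1‖ ≤
      2 * (1 / Real.sqrt ((M + M : ℕ) : ℝ) * (1 / Real.sqrt M)) := by
    intro l d hd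
    have : ∑ j : Fin M, conj (dft (M + M) ⟨d + j, hd j⟩ m) * dft M j l =
        (1 / (Real.sqrt ((M + M : ℕ) : ℝ) : ℂ)) * (1 / (Real.sqrt M : ℂ)) *
          circ ((d : ℝ) * ((m : ℕ) / ((M + M : ℕ) : ℝ))) *
          ∑ j : Fin M, circ ((j : ℕ) * ((((m : ℕ) : ℝ) - 2 * (l : ℕ)) / ((M + M : ℕ) : ℝ))) := by
      rw [mul_sum]
      refine sum_congr rfl fun j _ => ?_
      rw [dft_apply, dft_apply, map_mul, conj_inv_sqrt, conj_circ]
      have : circ (- -(((d + (j : ℕ) : ℕ) : ℝ) * (((m : ℕ) : ℝ) / ((M + M : ℕ) : ℝ)))) *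
          circ (-(((j : ℕ) : ℝ) * ((l : ℕ) / M))) =
          circ ((d : ℝ) * ((m : ℕ) / ((M + M : ℕ) : ℝ))) *
          circ ((j : ℕ) * ((((m : ℕ) : ℝ) - 2 * (l : ℕ)) / ((M + M : ℕ) : ℝ))) := by
        rw [← circ_add, ← circ_add]
        congr 1
        push_cast
        field_simp
        ring
      linear_combination ((1 / (Real.sqrt ((M + M : ℕ) : ℝ) : ℂ)) * (1 / (Real.sqrt M : ℂ))) * this
    rw [this, norm_mul, norm_mul, norm_circ, mul_one, norm_mul]
    have h1 : ∀ x : ℝ, 0 ≤ x → ‖(1 / (x : ℂ))‖ = 1 / x := fun x hx => by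
      rw [norm_div, norm_one, Complex.norm_real, Real.norm_of_nonneg hx]
    rw [h1 _ (Real.sqrt_nonneg _), h1 _ (Real.sqrt_nonneg _), mul_assoc]
    have h0 : 0 ≤ 1 / Real.sqrt ((M + M : ℕ) : ℝ) * (1 / Real.sqrt (M : ℝ)) := by positivity
    exact (mul_le_mul_of_nonneg_left (norm_sum_circ_mul_le M _) h0).trans_eq (mul_comm _ _)
  rw [quantumBaker_eq (by omega), Matrix.mul_apply, Fin.sum_univ_add]
  induction m' using Fin.addCases with
  | left l =>
    have := key l 0 (fun j => by omega)
    simp only [bakerMix_left_left, bakerMix_right_left, mul_zero, sum_const_zero, add_zero,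
      Matrix.conjTranspose_apply, Fin.val_castAdd]
    convert this using 8
    simp [Fin.castAdd, Fin.castLE]
  | right l =>
    have := key l M (fun j => by omega)
    simp only [bakerMix_left_right, bakerMix_right_right, mul_zero, sum_const_zero, zero_add,
      Matrix.conjTranspose_apply, Fin.val_natAdd]
    -- Replacing l by M + l changes the argument by exactly one full period.
    have h2 : circ ((((m : ℕ) : ℝ) - 2 * (l : ℕ)) / ((M + M : ℕ) : ℝ)) =
        circ ((((m : ℕ) : ℝ) - 2 * ((M + l : ℕ) : ℝ)) / ((M + M : ℕ) : ℝ)) := by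
      rw [← circ_add_intCast ((((m : ℕ) : ℝ) - 2 * ((M + l : ℕ) : ℝ)) / ((M + M : ℕ) : ℝ)) 1]
      congr 1
      push_cast
      field_simp
      ring
    rw [h2] at this
    exact this

/-! ### Cyclic total variation on ℤ/N. -/

section Variation

variable {N : ℕ} [NeZero N]

/-- The cyclic total variation of a function on `ℤ/N`. -/
def cyclicVar (u : Fin N → ℂ) : ℝ := ∑ x, ‖u (x + 1) - u x‖

lemma cyclicVar_nonneg (u : Fin N → ℂ) : 0 ≤ cyclicVar u := sum_nonneg fun _ _ => norm_nonneg _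

lemma sum_norm_shift_sub_le_nat (u : Fin N → ℂ) (k : ℕ) :
    ∑ x, ‖u (x + Fin.ofNat N k) - u x‖ ≤ k * cyclicVar u := by
  induction k with
  | zero => simp
  | succ k ih =>
    have hk : Fin.ofNat N (k + 1) = Fin.ofNat N k + 1 := by
      ext; simp [Fin.val_add]
    calc ∑ x, ‖u (x + Fin.ofNat N (k + 1)) - u x‖
        ≤ ∑ x, (‖u (x + Fin.ofNat N k + 1) - u (x + Fin.ofNat N k)‖ +
            ‖u (x + Fin.ofNat N k) - u x‖) := by
          refine sum_le_sum fun x _ => ?_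
          rw [hk, ← add_assoc]
          exact norm_sub_le_norm_sub_add_norm_sub _ _ _
      _ = cyclicVar u + ∑ x, ‖u (x + Fin.ofNat N k) - u x‖ := by
          rw [sum_add_distrib]
          congr 1
          exact Equiv.sum_comp (Equiv.addRight (Fin.ofNat N k)) fun y => ‖u (y + 1) - u y‖
      _ ≤ _ := by push_cast; linarith

/-- The distance of a residue class to `0`. -/
def cyclicDist (r : Fin N) : ℝ := min (r : ℕ) (N - (r : ℕ))

lemma cyclicDist_pos {r : Fin N} (hr : r ≠ 0) : 0 < cyclicDist r := by
  have h1 : 0 < (r : ℕ) := Nat.pos_of_ne_zero fun h => hr (Fin.ext h)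
  have h2 := r.2
  refine lt_min (by exact_mod_cast h1) (sub_pos.2 (by exact_mod_cast h2))

/-- A shift by r is r forward unit steps or N - r backward ones. -/
lemma sum_norm_shift_sub_le (u : Fin N → ℂ) (r : Fin N) :
    ∑ x, ‖u (x + r) - u x‖ ≤ cyclicDist r * cyclicVar u := by
  have h : ∀ r : Fin N, ∑ x, ‖u (x + r) - u x‖ ≤ (r : ℕ) * cyclicVar u := by
    intro r
    have := sum_norm_shift_sub_le_nat u (r : ℕ)
    rwa [show Fin.ofNat N (r : ℕ) = r by ext; simp] at this
  by_cases hr : r = 0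
  · subst hr
    have := h 0
    simp only [add_zero, sub_self, norm_zero, sum_const_zero] at this ⊢
    simp [cyclicDist]
  have h2 : ∑ x, ‖u (x + r) - u x‖ ≤ (N - (r : ℕ)) * cyclicVar u := by
    have h3 := h (-r)
    have h4 : ∑ x, ‖u (x + -r) - u x‖ = ∑ x, ‖u (x + r) - u x‖ := by
      rw [← Equiv.sum_comp (Equiv.addRight r)]
      refine sum_congr rfl fun x _ => ?_
      simp only [Equiv.coe_addRight, add_neg_cancel_right]
      rw [norm_sub_rev]
    have h5 : ((-r : Fin N) : ℕ) = N - (r : ℕ) := by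
      have h1 : 0 < (r : ℕ) := Nat.pos_of_ne_zero fun h => hr (Fin.ext h)
      rw [Fin.val_neg, if_neg hr]
    rw [h4, h5, Nat.cast_sub r.2.le] at h3
    exact h3
  rw [cyclicDist, min_mul_of_nonneg _ _ (cyclicVar_nonneg u)]
  exact le_min (h r) h2

/-- Bounding 1/min by the sum of both reciprocals leaves two harmonic sums. The term r = 0 is 1/0 =
0. -/
lemma sum_inv_cyclicDist_le : ∑ r : Fin N, 1 / cyclicDist r ≤ 2 * (1 + Real.log N) := by
  have hH : ∑ i ∈ range N, (1 : ℝ) / (i + 1) ≤ 1 + Real.log N := by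
    have := harmonic_le_one_add_log N
    simp only [harmonic, Rat.cast_sum, Rat.cast_inv, Rat.cast_natCast] at this
    simpa using this
  have h1 : ∑ r : Fin N, (1 : ℝ) / (N - (r : ℕ)) ≤ 1 + Real.log N := by
    refine le_of_eq_of_le ?_ hH
    rw [Fin.sum_univ_eq_sum_range (fun r : ℕ => (1 : ℝ) / (N - r)), ← sum_range_reflect]
    refine sum_congr rfl fun i hi => ?_
    rw [mem_range] at hi
    rw [Nat.cast_sub (by omega), Nat.cast_sub (by omega)]
    push_cast; ring_nf
  have h2 : ∑ r : Fin N, (1 : ℝ) / (r : ℕ) ≤ 1 + Real.log N := by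
    refine le_trans ?_ hH
    obtain ⟨K, hK⟩ : ∃ K, N = K + 1 := ⟨N - 1, by have := NeZero.pos N; omega⟩
    rw [Fin.sum_univ_eq_sum_range (fun r : ℕ => (1 : ℝ) / r), hK, sum_range_succ', sum_range_succ]
    push_cast
    simp only [div_zero, add_zero]
    have : (0 : ℝ) ≤ 1 / (K + 1) := by positivity
    linarith
  calc ∑ r : Fin N, 1 / cyclicDist r
      ≤ ∑ r : Fin N, ((1 : ℝ) / (r : ℕ) + 1 / (N - (r : ℕ))) := by
        refine sum_le_sum fun r _ => ?_
        have hr : (0 : ℝ) < N - (r : ℕ) := sub_pos.2 (by exact_mod_cast r.2)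
        rw [cyclicDist]
        rcases min_cases ((r : ℕ) : ℝ) (N - (r : ℕ)) with ⟨h, _⟩ | ⟨h, _⟩ <;> rw [h]
        · have : 0 ≤ 1 / ((N : ℝ) - (r : ℕ)) := by positivity
          linarith
        · have : 0 ≤ 1 / ((r : ℕ) : ℝ) := by positivity
          linarith
    _ ≤ _ := by rw [sum_add_distrib]; linarith

end Variation

/-! ### The doubling map on ℤ/2M and the commutator estimate. -/

section Even

variable {M : ℕ} [NeZero M]

lemma val_castAdd_add_self (l : Fin M) :
    ((Fin.castAdd M l + Fin.castAdd M l : Fin (M + M)) : ℕ) = 2 * l := by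
  rw [Fin.val_add, Fin.val_castAdd, Nat.mod_eq_of_lt (by omega)]; omega

lemma natAdd_add_self (l : Fin M) :
    (Fin.natAdd M l + Fin.natAdd M l : Fin (M + M)) = Fin.castAdd M l + Fin.castAdd M l := by
  ext
  rw [val_castAdd_add_self, Fin.val_add, Fin.val_natAdd,
    show M + (l : ℕ) + (M + l) = 2 * l + (M + M) by omega, Nat.add_mod_right,
    Nat.mod_eq_of_lt (by omega)]

/-- Doubling on ℤ/2M is two-to-one onto the even residues. -/
lemma sum_comp_double_le {f : Fin (M + M) → ℝ} (hf : ∀ x, 0 ≤ f x) :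
    ∑ x, f (x + x) ≤ 2 * ∑ x, f x := by
  rw [Fin.sum_univ_add]
  simp only [natAdd_add_self]
  rw [← two_mul]
  gcongr
  have hinj : Function.Injective fun l : Fin M => Fin.castAdd M l + Fin.castAdd M l := by
    intro a b hab
    have := congrArg Fin.val hab
    simp only [val_castAdd_add_self] at this
    ext; omega
  calc ∑ l : Fin M, f (Fin.castAdd M l + Fin.castAdd M l)
      = ∑ x ∈ univ.image fun l : Fin M => Fin.castAdd M l + Fin.castAdd M l, f x := by
        rw [sum_image fun a _ b _ h => hinj h]
    _ ≤ _ := sum_le_univ_sum_of_nonneg hf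

/-- Composition with the doubling map of `ℤ/N`. -/
def double (u : Fin (M + M) → ℂ) (x : Fin (M + M)) : ℂ := u (x + x)

/-- A unit step becomes two unit steps after doubling, and each residue is reached at most twice. -/
lemma cyclicVar_double_le (u : Fin (M + M) → ℂ) : cyclicVar (double u) ≤ 4 * cyclicVar u := by
  calc cyclicVar (double u)
      ≤ ∑ x, (‖u (x + x + 1 + 1) - u (x + x + 1)‖ + ‖u (x + x + 1) - u (x + x)‖) := by
        refine sum_le_sum fun x _ => ?_
        rw [double, double, show x + 1 + (x + 1) = x + x + 1 + 1 by abel]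
        exact norm_sub_le_norm_sub_add_norm_sub _ _ _
    _ ≤ 2 * ∑ x, ‖u (x + 1 + 1) - u (x + 1)‖ + 2 * ∑ x, ‖u (x + 1) - u x‖ := by
        rw [sum_add_distrib]
        exact add_le_add
          (sum_comp_double_le (f := fun y => ‖u (y + 1 + 1) - u (y + 1)‖) fun _ => norm_nonneg _)
          (sum_comp_double_le (f := fun y => ‖u (y + 1) - u y‖) fun _ => norm_nonneg _)
    _ = _ := by
        have := Equiv.sum_comp (Equiv.addRight (1 : Fin (M + M))) fun y => ‖u (y + 1) - u y‖
        simp only [Equiv.coe_addRight] at this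
        rw [this, cyclicVar]; ring

/-- The geometric-sum bound divided by Jordan's lower bound, with m - 2m' reduced to its
representative in [0, N) by periodicity. -/
lemma norm_quantumBaker_sq_le {m m' : Fin (M + M)} (h : m - (m' + m') ≠ 0) :
    ‖quantumBaker (M + M) m m'‖ ^ 2 ≤ 1 / (2 * cyclicDist (m - (m' + m')) ^ 2) := by
  have hM : 0 < M := NeZero.pos M
  have hM' : (0 : ℝ) < M := by exact_mod_cast hM
  set r := m - (m' + m') with hr
  have hN : (0 : ℝ) < ((M + M : ℕ) : ℝ) := by positivity
  have hB := norm_quantumBaker_mul_le hM m m'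
  have hcirc : circ ((((m : ℕ) : ℝ) - 2 * (m' : ℕ)) / ((M + M : ℕ) : ℝ)) =
      circ (((r : ℕ) : ℝ) / ((M + M : ℕ) : ℝ)) := by
    have hm : m = r + (m' + m') := by rw [hr]; abel
    have hmod : ((m : ℕ) : ℤ) ≡ (r : ℕ) + ((m' : ℕ) + (m' : ℕ)) [ZMOD ((M + M : ℕ) : ℤ)] := by
      have : (m : ℕ) ≡ (r : ℕ) + ((m' : ℕ) + (m' : ℕ)) [MOD (M + M)] := by
        conv_lhs => rw [hm]
        simp [Nat.ModEq, Fin.val_add]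
      exact_mod_cast (Int.natCast_modEq_iff.2 this)
    obtain ⟨k, hk⟩ := hmod.dvd
    have hk' : ((r : ℕ) : ℝ) + ((m' : ℕ) + (m' : ℕ)) - (m : ℕ) = ((M + M : ℕ) : ℝ) * k := by
      exact_mod_cast hk
    rw [← circ_add_intCast _ k]
    congr 1
    field_simp
    linarith
  rw [hcirc] at hB
  have hr1 : ((r : ℕ) : ℝ) < ((M + M : ℕ) : ℝ) := by exact_mod_cast r.2
  have hlow := le_norm_circ_sub_one (x := ((r : ℕ) : ℝ) / ((M + M : ℕ) : ℝ)) (by positivity)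
    ((div_le_one hN).2 hr1.le)
  have hdist : min (((r : ℕ) : ℝ) / ((M + M : ℕ) : ℝ)) (1 - ((r : ℕ) : ℝ) / ((M + M : ℕ) : ℝ)) =
      cyclicDist r / ((M + M : ℕ) : ℝ) := by
    rw [cyclicDist, ← min_div_div_right hN.le]
    congr 1
    field_simp
  rw [hdist] at hlow
  have hd := cyclicDist_pos h
  set d := cyclicDist r
  set b := ‖quantumBaker (M + M) m m'‖
  have hb : 0 ≤ b := norm_nonneg _
  have h1 : b * (4 * (d / ((M + M : ℕ) : ℝ))) ≤
      2 * (1 / Real.sqrt ((M + M : ℕ) : ℝ) * (1 / Real.sqrt M)) :=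
    (mul_le_mul_of_nonneg_left hlow hb).trans hB
  have h2 := pow_le_pow_left₀ (by positivity) h1 2
  have h3 : (2 * (1 / Real.sqrt ((M + M : ℕ) : ℝ) * (1 / Real.sqrt M))) ^ 2 = 2 / (M : ℝ) ^ 2 := by
    rw [mul_pow, mul_pow, div_pow, div_pow, Real.sq_sqrt (by positivity), Real.sq_sqrt hM'.le]
    push_cast
    field_simp
    ring
  rw [h3] at h2
  have h4 : (b * (4 * (d / ((M + M : ℕ) : ℝ)))) ^ 2 = b ^ 2 * (4 * d ^ 2 / (M : ℝ) ^ 2) := by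
    push_cast
    field_simp
    ring
  rw [h4] at h2
  rw [le_div_iff₀ (by positivity)]
  have h5 : b ^ 2 * (4 * d ^ 2 / (M : ℝ) ^ 2) = (b ^ 2 * (2 * d ^ 2)) * (2 / (M : ℝ) ^ 2) := by ring
  rw [h5] at h2
  have h6 : (0 : ℝ) < 2 / (M : ℝ) ^ 2 := by positivity
  exact le_of_mul_le_mul_right (by linarith) h6

/-- The Hilbert–Schmidt size of the commutator of the baker's map with the doubling. -/
lemma sum_norm_quantumBaker_sq_mul_le {u : Fin (M + M) → ℂ} (hu : ∀ x, ‖u x‖ ≤ 1) :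
    ∑ m, ∑ m', ‖quantumBaker (M + M) m m'‖ ^ 2 * ‖u m - double u m'‖ ^ 2 ≤
      4 * (1 + Real.log ((M + M : ℕ) : ℝ)) * cyclicVar u := by
  have key : ∀ m m' : Fin (M + M), ‖quantumBaker (M + M) m m'‖ ^ 2 * ‖u m - double u m'‖ ^ 2 ≤
      1 / cyclicDist (m - (m' + m')) ^ 2 * ‖u m - double u m'‖ := by
    intro m m'
    by_cases h : m - (m' + m') = 0
    · rw [sub_eq_zero] at h
      simp [double, h]
    -- One power of the difference is bounded by 2, so that the total variation, rather than a
    -- quadratic variation, controls the sum.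
    · have h1 := norm_quantumBaker_sq_le h
      have h2 : ‖u m - double u m'‖ ≤ 2 := by
        have := norm_sub_le (u m) (double u m')
        have h3 := hu m
        have h4 := hu (m' + m')
        rw [double] at this ⊢
        linarith
      have h0 := norm_nonneg (u m - double u m')
      calc _ ≤ 1 / (2 * cyclicDist (m - (m' + m')) ^ 2) * (2 * ‖u m - double u m'‖) := by
            gcongr
            nlinarith
        _ = _ := by
            have := (cyclicDist_pos h).ne'
            field_simp
  calc _ ≤ ∑ m, ∑ m', 1 / cyclicDist (m - (m' + m')) ^ 2 * ‖u m - double u m'‖ :=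
        sum_le_sum fun m _ => sum_le_sum fun m' _ => key m m'
    _ = ∑ m', ∑ r, 1 / cyclicDist r ^ 2 * ‖u (m' + m' + r) - u (m' + m')‖ := by
        rw [sum_comm]
        refine sum_congr rfl fun m' _ => ?_
        rw [← Equiv.sum_comp (Equiv.addLeft (m' + m'))]
        refine sum_congr rfl fun r _ => ?_
        simp only [Equiv.coe_addLeft, double]
        rw [add_sub_cancel_left]
    _ = ∑ r, 1 / cyclicDist r ^ 2 * ∑ m', ‖u (m' + m' + r) - u (m' + m')‖ := by
        rw [sum_comm]
        simp only [mul_sum]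
    -- The shift estimate cancels one of the two powers of the distance; a harmonic sum is left,
    -- whence the logarithm.
    _ ≤ ∑ r, 2 * cyclicVar u * (1 / cyclicDist r) := by
        refine sum_le_sum fun r _ => ?_
        have h1 : ∑ m', ‖u (m' + m' + r) - u (m' + m')‖ ≤ 2 * (cyclicDist r * cyclicVar u) :=
          (sum_comp_double_le (f := fun y => ‖u (y + r) - u y‖) fun _ => norm_nonneg _).trans
            (mul_le_mul_of_nonneg_left (sum_norm_shift_sub_le u r) (by norm_num))
        calc _ ≤ 1 / cyclicDist r ^ 2 * (2 * (cyclicDist r * cyclicVar u)) := by gcongr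
          _ = _ := by
            by_cases hr : r = 0
            · subst hr; simp [cyclicDist]
            · have := (cyclicDist_pos hr).ne'
              field_simp
    _ = 2 * cyclicVar u * ∑ r, 1 / cyclicDist r := by rw [mul_sum]
    _ ≤ 2 * cyclicVar u * (2 * (1 + Real.log ((M + M : ℕ) : ℝ))) := by
        gcongr
        · exact mul_nonneg (by norm_num) (cyclicVar_nonneg u)
        · exact sum_inv_cyclicDist_le
    _ = _ := by ring

end Even

/-! ### Heisenberg evolution and Egorov theorems in Hilbert–Schmidt norm. -/

section Evolution

variable {M : ℕ} [NeZero M]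

/-- Heisenberg evolution `X ↦ B⁻ᵗ X Bᵗ` under the quantised baker's map. -/
def evolve (t : ℕ) (X : Matrix (Fin (M + M)) (Fin (M + M)) ℂ) :
    Matrix (Fin (M + M)) (Fin (M + M)) ℂ :=
  (quantumBaker (M + M) ^ t)ᴴ * X * quantumBaker (M + M) ^ t

lemma quantumBaker_pow_unitary (t : ℕ) :
    (quantumBaker (M + M) ^ t)ᴴ * quantumBaker (M + M) ^ t = 1 := by
  have h : quantumBaker (M + M) ∈ unitary (Matrix (Fin (M + M)) (Fin (M + M)) ℂ) := by
    have := quantumBaker_unitary (NeZero.pos M)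
    exact Unitary.mem_iff.2 ⟨this, mul_eq_one_comm.1 this⟩
  exact (Unitary.mem_iff.1 (pow_mem h t)).1

lemma conjTranspose_unitary {n : Type*} [Fintype n] [DecidableEq n] {U : Matrix n n ℂ}
    (hU : Uᴴ * U = 1) : Uᴴᴴ * Uᴴ = 1 := by
  rw [Matrix.conjTranspose_conjTranspose]; exact mul_eq_one_comm.1 hU

lemma evolve_zero (X : Matrix (Fin (M + M)) (Fin (M + M)) ℂ) : evolve 0 X = X := by
  simp [evolve]

lemma evolve_add_time (s t : ℕ) (X : Matrix (Fin (M + M)) (Fin (M + M)) ℂ) :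
    evolve (s + t) X = evolve s (evolve t X) := by
  rw [evolve, evolve, evolve, add_comm s t, pow_add, Matrix.conjTranspose_mul]
  simp only [Matrix.mul_assoc]

lemma evolve_succ (t : ℕ) (X : Matrix (Fin (M + M)) (Fin (M + M)) ℂ) :
    evolve (t + 1) X = evolve t (evolve 1 X) := evolve_add_time t 1 X

lemma evolve_add (t : ℕ) (X Y : Matrix (Fin (M + M)) (Fin (M + M)) ℂ) :
    evolve t (X + Y) = evolve t X + evolve t Y := by
  rw [evolve, Matrix.mul_add, Matrix.add_mul]; rfl

lemma evolve_sub (t : ℕ) (X Y : Matrix (Fin (M + M)) (Fin (M + M)) ℂ) :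
    evolve t (X - Y) = evolve t X - evolve t Y := by
  rw [evolve, Matrix.mul_sub, Matrix.sub_mul]; rfl

lemma evolve_mul (t : ℕ) (X Y : Matrix (Fin (M + M)) (Fin (M + M)) ℂ) :
    evolve t (X * Y) = evolve t X * evolve t Y := by
  have h : quantumBaker (M + M) ^ t * (quantumBaker (M + M) ^ t)ᴴ = 1 :=
    mul_eq_one_comm.1 (quantumBaker_pow_unitary t)
  rw [evolve, evolve, evolve]
  set U := quantumBaker (M + M) ^ t
  calc Uᴴ * (X * Y) * U = Uᴴ * X * 1 * Y * U := by simp only [Matrix.mul_assoc, Matrix.one_mul]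
    _ = _ := by rw [← h]; simp only [Matrix.mul_assoc]

lemma hsNorm_evolve (t : ℕ) (X : Matrix (Fin (M + M)) (Fin (M + M)) ℂ) :
    hsNorm (evolve t X) = hsNorm X :=
  hsNorm_unitary (conjTranspose_unitary (quantumBaker_pow_unitary t)) (quantumBaker_pow_unitary t) X

lemma hsInner_evolve (t : ℕ) (X Y : Matrix (Fin (M + M)) (Fin (M + M)) ℂ) :
    hsInner (evolve t X) (evolve t Y) = hsInner X Y :=
  hsInner_unitary (conjTranspose_unitary (quantumBaker_pow_unitary t)) (quantumBaker_pow_unitary t)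
    X Y

/-- The Egorov error in Hilbert–Schmidt norm for a symbol of variation `V`. -/
def egorovError (N : ℕ) (V : ℝ) : ℝ := 4 * Real.sqrt V * Real.sqrt (Real.sqrt N)

lemma egorovError_nonneg (N : ℕ) (V : ℝ) : 0 ≤ egorovError N V := by
  unfold egorovError; positivity

lemma egorovError_mono (N : ℕ) {V W : ℝ} (h : V ≤ W) : egorovError N V ≤ egorovError N W := by
  unfold egorovError; gcongr

lemma egorovError_sq (N : ℕ) {V : ℝ} (hV : 0 ≤ V) :
    egorovError N V ^ 2 = 16 * V * Real.sqrt N := by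
  rw [egorovError, mul_pow, mul_pow, Real.sq_sqrt hV, Real.sq_sqrt (Real.sqrt_nonneg _)]
  ring

/-- The logarithm is given away for √N: the squared Egorov error only has to be a power smaller than
N. -/
lemma four_mul_one_add_log_le {N : ℕ} (hN : 0 < N) :
    4 * (1 + Real.log N) ≤ 16 * Real.sqrt N := by
  have h1 : (1 : ℝ) ≤ Real.sqrt N := Real.one_le_sqrt.2 (by exact_mod_cast hN)
  have h2 := Real.log_le_self (Real.sqrt_nonneg N)
  rw [Real.log_sqrt (Nat.cast_nonneg N)] at h2
  linarith

lemma sum_commutator_le {u : Fin (M + M) → ℂ} (hu : ∀ x, ‖u x‖ ≤ 1) :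
    ∑ m, ∑ m', ‖quantumBaker (M + M) m m'‖ ^ 2 * ‖u m - double u m'‖ ^ 2 ≤
      egorovError (M + M) (cyclicVar u) ^ 2 := by
  refine (sum_norm_quantumBaker_sq_mul_le hu).trans ?_
  rw [egorovError_sq _ (cyclicVar_nonneg u)]
  have h0 := cyclicVar_nonneg u
  have := four_mul_one_add_log_le (N := M + M) (by have := NeZero.pos M; omega)
  nlinarith

/-- Egorov's theorem for functions of position. -/
lemma hsNorm_evolve_diagonal_sub_le {u : Fin (M + M) → ℂ} (hu : ∀ x, ‖u x‖ ≤ 1) :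
    hsNorm (evolve 1 (diagonal u) - diagonal (double u)) ≤ egorovError (M + M) (cyclicVar u) := by
  have hB := quantumBaker_unitary (NeZero.pos M)
  set B := quantumBaker (M + M) with hBdef
  have : evolve 1 (diagonal u) - diagonal (double u) =
      Bᴴ * (diagonal u * B - B * diagonal (double u)) := by
    rw [evolve, pow_one, ← hBdef, Matrix.mul_sub, ← Matrix.mul_assoc, ← Matrix.mul_assoc, hB,
      Matrix.one_mul]
  rw [this, hsNorm_unitary_mul (conjTranspose_unitary hB)]
  refine hsNorm_le_of_sq (egorovError_nonneg _ _) (le_of_eq_of_le ?_ (sum_commutator_le hu))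
  refine sum_congr rfl fun m _ => sum_congr rfl fun m' _ => ?_
  rw [Matrix.sub_apply, diagonal_mul, mul_diagonal, mul_comm (B m m'), ← sub_mul, norm_mul, mul_pow,
    mul_comm]

/-- The momentum operators of the whole torus and of its two halves nearly agree. -/
lemma hsNorm_dft_conj_sub_le {u : Fin (M + M) → ℂ} (hu : ∀ x, ‖u x‖ ≤ 1) :
    hsNorm ((bakerMix (M + M))ᴴ * diagonal (double u) * bakerMix (M + M) -
      (dft (M + M))ᴴ * diagonal u * dft (M + M)) ≤ egorovError (M + M) (cyclicVar u) := by
  have hF := dft_unitary (N := M + M) (by have := NeZero.pos M; omega)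
  have hK := bakerMix_unitary (NeZero.pos M)
  have hE : ∀ i j, (dft (M + M) * (bakerMix (M + M))ᴴ) i j = conj (quantumBaker (M + M) i j) :=
    dft_mul_bakerMix_conjTranspose (NeZero.pos M)
  set F := dft (M + M)
  set K := bakerMix (M + M)
  -- Pulling out the unitaries F* and K leaves a commutator-type difference for F K*, whose entries
  -- have the same moduli as those of the baker's map.
  have : Kᴴ * diagonal (double u) * K - Fᴴ * diagonal u * F =
      Fᴴ * ((F * Kᴴ) * diagonal (double u) - diagonal u * (F * Kᴴ)) * K := by
    rw [Matrix.mul_sub, Matrix.sub_mul]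
    congr 1
    · calc Kᴴ * diagonal (double u) * K = (Fᴴ * F) * Kᴴ * diagonal (double u) * K := by
            rw [hF, Matrix.one_mul]
        _ = _ := by simp only [Matrix.mul_assoc]
    · calc Fᴴ * diagonal u * F = Fᴴ * diagonal u * F * (Kᴴ * K) := by rw [hK, Matrix.mul_one]
        _ = _ := by simp only [Matrix.mul_assoc]
  rw [this, hsNorm_unitary (conjTranspose_unitary hF) hK]
  refine hsNorm_le_of_sq (egorovError_nonneg _ _) (le_of_eq_of_le ?_ (sum_commutator_le hu))
  refine sum_congr rfl fun m _ => sum_congr rfl fun m' _ => ?_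
  rw [Matrix.sub_apply, diagonal_mul, mul_diagonal, hE, mul_comm (u m), ← mul_sub, norm_mul,
    mul_pow, RCLike.norm_conj, norm_sub_rev]

lemma norm_iterate_double_le {u : Fin (M + M) → ℂ} {c : ℝ} (hu : ∀ x, ‖u x‖ ≤ c) (t : ℕ)
    (x : Fin (M + M)) : ‖double^[t] u x‖ ≤ c := by
  induction t generalizing u with
  | zero => exact hu x
  | succ t ih =>
    rw [Function.iterate_succ_apply]
    exact ih fun x => hu (x + x)

/-- Long-time Egorov theorem for functions of position. -/
lemma hsNorm_evolve_diagonal_sub_iterate_le {u : Fin (M + M) → ℂ} (hu : ∀ x, ‖u x‖ ≤ 1) (t : ℕ) :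
    hsNorm (evolve t (diagonal u) - diagonal (double^[t] u)) ≤
      t * egorovError (M + M) (4 ^ t * cyclicVar u) := by
  induction t generalizing u with
  | zero => simp [evolve_zero, hsNorm]
  | succ t ih =>
    -- The one-step error is merely conjugated by unitaries afterwards, so errors add; only the
    -- variation of the symbol grows, by a factor 4 per step.
    have h1 : evolve (t + 1) (diagonal u) - diagonal (double^[t + 1] u) =
        evolve t (evolve 1 (diagonal u) - diagonal (double u)) +
          (evolve t (diagonal (double u)) - diagonal (double^[t] (double u))) := by
      rw [evolve_succ, evolve_sub, Function.iterate_succ_apply]; abel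
    rw [h1]
    refine (hsNorm_add_le _ _).trans ?_
    rw [hsNorm_evolve]
    have h2 := hsNorm_evolve_diagonal_sub_le hu
    have h3 := ih (u := double u) fun x => hu (x + x)
    have hV := cyclicVar_nonneg u
    have hp : (1 : ℝ) ≤ 4 ^ (t + 1) := one_le_pow₀ (by norm_num)
    have h4 : egorovError (M + M) (cyclicVar u) ≤
        egorovError (M + M) (4 ^ (t + 1) * cyclicVar u) := egorovError_mono _ (by nlinarith)
    have h5 : egorovError (M + M) (4 ^ t * cyclicVar (double u)) ≤
        egorovError (M + M) (4 ^ (t + 1) * cyclicVar u) := by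
      apply egorovError_mono
      rw [pow_succ, mul_assoc]
      gcongr
      exact cyclicVar_double_le u
    have h6 := mul_le_mul_of_nonneg_left h5 (Nat.cast_nonneg (α := ℝ) t)
    push_cast
    linarith

/-- The samples of a function on the circle at the points `m / N`. -/
def sample (N : ℕ) (g : ℝ → ℂ) (m : Fin N) : ℂ := g ((m : ℕ) / N)

/-- The N steps of length 1/N account for one l. The other l pays for the wrap-around, since g need
not be periodic. -/
lemma cyclicVar_sample_le {N : ℕ} [NeZero N] {g : ℝ → ℂ} {l : ℝ}
    (hg : ∀ x y, ‖g x - g y‖ ≤ l * |x - y|) : cyclicVar (sample N g) ≤ 2 * l := by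
  have hl : 0 ≤ l := by
    have := (norm_nonneg _).trans (hg 1 0)
    simpa using this
  have hN : (0 : ℝ) < N := by exact_mod_cast NeZero.pos N
  have hterm : ∀ x : Fin N, ‖sample N g (x + 1) - sample N g x‖ ≤
      l / N + if (x : ℕ) = N - 1 then l else 0 := by
    intro x
    refine (hg _ _).trans ?_
    have hx := x.2
    by_cases h : (x : ℕ) = N - 1
    · rw [if_pos h]
      have hv : ((x + 1 : Fin N) : ℕ) < N := (x + 1).2
      have h1 : (((x + 1 : Fin N) : ℕ) : ℝ) / N ≤ 1 := (div_le_one hN).2 (by exact_mod_cast hv.le)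
      have h2 : ((x : ℕ) : ℝ) / N ≤ 1 := (div_le_one hN).2 (by exact_mod_cast hx.le)
      have h3 : |(((x + 1 : Fin N) : ℕ) : ℝ) / N - ((x : ℕ) : ℝ) / N| ≤ 1 := by
        have a1 : 0 ≤ (((x + 1 : Fin N) : ℕ) : ℝ) / N := by positivity
        have a2 : 0 ≤ ((x : ℕ) : ℝ) / N := by positivity
        rw [abs_le]; constructor <;> linarith
      have : 0 ≤ l / N := by positivity
      nlinarith
    · have hv : ((x + 1 : Fin N) : ℕ) = x + 1 := by
        rw [Fin.val_add, Fin.val_one', Nat.add_mod_mod, Nat.mod_eq_of_lt (by omega)]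
      rw [if_neg h, hv]
      have : (((x : ℕ) + 1 : ℕ) : ℝ) / N - ((x : ℕ) : ℝ) / N = 1 / N := by push_cast; ring
      rw [this, abs_of_nonneg (by positivity)]
      rw [mul_one_div, add_zero]
  calc cyclicVar (sample N g) ≤ ∑ x : Fin N, (l / N + if (x : ℕ) = N - 1 then l else 0) :=
        sum_le_sum fun x _ => hterm x
    _ = l + l := by
        rw [sum_add_distrib, sum_const, card_univ, Fintype.card_fin, nsmul_eq_mul,
          mul_div_cancel₀ _ hN.ne']
        congr 1
        have hlast : N - 1 < N := by have := NeZero.pos N; omega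
        rw [Fintype.sum_eq_single (⟨N - 1, hlast⟩ : Fin N)]
        · simp
        · intro x hx
          rw [if_neg fun h => hx (Fin.ext h)]
    _ = _ := by ring

/-- The left half of the position interval. -/
def leftHalf (x : Fin (M + M)) : Prop := (x : ℕ) < M

lemma cyclicVar_indic_leftHalf_le : cyclicVar (indic (leftHalf (M := M))) ≤ 2 := by
  have hM := NeZero.pos M
  have hterm : ∀ x : Fin (M + M), ‖indic leftHalf (x + 1) - indic leftHalf x‖ ≤
      (if (x : ℕ) = M - 1 then (1 : ℝ) else 0) + if (x : ℕ) = M + M - 1 then (1 : ℝ) else 0 := by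
    intro x
    have hx := x.2
    by_cases h2 : (x : ℕ) = M + M - 1
    · have hv : ((x + 1 : Fin (M + M)) : ℕ) = 0 := by
        rw [Fin.val_add, Fin.val_one', Nat.add_mod_mod, h2, Nat.sub_add_cancel (by omega),
          Nat.mod_self]
      unfold indic leftHalf
      rw [hv, if_pos hM, if_neg (by omega), if_neg (by omega), if_pos h2]
      simp
    · have hv : ((x + 1 : Fin (M + M)) : ℕ) = x + 1 := by
        rw [Fin.val_add, Fin.val_one', Nat.add_mod_mod, Nat.mod_eq_of_lt (by omega)]
      unfold indic leftHalf
      rw [hv]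
      split_ifs <;> first | omega | simp
  calc _ ≤ ∑ x : Fin (M + M), ((if (x : ℕ) = M - 1 then (1 : ℝ) else 0) +
        if (x : ℕ) = M + M - 1 then (1 : ℝ) else 0) := sum_le_sum fun x _ => hterm x
    _ = 1 + 1 := by
        rw [sum_add_distrib]
        congr 1
        · rw [Fintype.sum_eq_single (⟨M - 1, by omega⟩ : Fin (M + M))]
          · simp
          · intro x hx
            rw [if_neg fun h => hx (Fin.ext h)]
        · rw [Fintype.sum_eq_single (⟨M + M - 1, by omega⟩ : Fin (M + M))]
          · simp
          · intro x hx
            rw [if_neg fun h => hx (Fin.ext h)]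
    _ = 2 := by norm_num

lemma cyclicVar_indic_not (s : Fin (M + M) → Prop) :
    cyclicVar (indic fun x => ¬ s x) = cyclicVar (indic s) := by
  refine sum_congr rfl fun x _ => ?_
  rw [indic_not, indic_not, norm_sub_rev]
  congr 1
  ring

/-- One predicate s' serves both halves, so the evolved indicators remain complementary and
`offNorm_indic_add_le` applies at every time. -/
lemma iterate_double_indic (s : Fin (M + M) → Prop) (t : ℕ) :
    ∃ s' : Fin (M + M) → Prop, double^[t] (indic s) = indic s' ∧
      double^[t] (indic fun x => ¬ s x) = indic fun x => ¬ s' x := by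
  induction t generalizing s with
  | zero => exact ⟨s, rfl, rfl⟩
  | succ t ih => exact ih fun x => s (x + x)

/-! ### Evolution of functions of momentum. -/

/-- The function `g(p̂)` of the momentum operator. -/
def momentumOp (N : ℕ) (g : ℝ → ℂ) : Matrix (Fin N) (Fin N) ℂ :=
  (dft N)ᴴ * diagonal (sample N g) * dft N

lemma hsNorm_mul_evolve_momentumOp_le {g : ℝ → ℂ} (hg : ∀ x, ‖g x‖ ≤ 1) (t : ℕ)
    (X : Matrix (Fin (M + M)) (Fin (M + M)) ℂ) :
    hsNorm (X * evolve t (momentumOp (M + M) g)) ≤ hsNorm X := by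
  have hF := dft_unitary (N := M + M) (by have := NeZero.pos M; omega)
  have hU := quantumBaker_pow_unitary (M := M) t
  rw [evolve, momentumOp]
  set U := quantumBaker (M + M) ^ t
  set F := dft (M + M)
  rw [show X * (Uᴴ * (Fᴴ * diagonal (sample (M + M) g) * F) * U) =
    X * Uᴴ * Fᴴ * diagonal (sample (M + M) g) * F * U by simp only [Matrix.mul_assoc]]
  rw [hsNorm_mul_unitary hU, hsNorm_mul_unitary hF]
  refine (hsNorm_mul_diagonal_le zero_le_one (fun i => hg _) _).trans ?_
  rw [one_mul, hsNorm_mul_unitary (conjTranspose_unitary hF),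
    hsNorm_mul_unitary (conjTranspose_unitary hU)]

/-- Comparison with the scalar matrix g(0), which is diagonal in position as well as in momentum. -/
lemma offNorm_momentumOp_le {N : ℕ} (hN : 0 < N) {g : ℝ → ℂ} {l : ℝ}
    (hg : ∀ x y, ‖g x - g y‖ ≤ l * |x - y|) : offNorm (momentumOp N g) ≤ l * Real.sqrt N := by
  have hl : 0 ≤ l := by
    have := (norm_nonneg _).trans (hg 1 0)
    simpa using this
  have hF := dft_unitary hN
  have h := offNorm_le_add (momentumOp N g) (diagonal fun _ => g 0)
  rw [offNorm_diagonal, zero_add] at h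
  refine h.trans ?_
  have : momentumOp N g - diagonal (fun _ => g 0) =
      (dft N)ᴴ * diagonal (fun m => sample N g m - g 0) * dft N := by
    have h1 : (diagonal fun _ => g 0 : Matrix (Fin N) (Fin N) ℂ) = g 0 • 1 := by
      rw [Matrix.smul_one_eq_diagonal]
    have h2 : diagonal (fun m => sample N g m - g 0) =
        diagonal (sample N g) - g 0 • (1 : Matrix (Fin N) (Fin N) ℂ) := by
      rw [← h1, Matrix.diagonal_sub]
    rw [h1, h2, momentumOp, Matrix.mul_sub, Matrix.sub_mul, Matrix.mul_smul, Matrix.mul_one,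
      Matrix.smul_mul, hF]
  rw [this, hsNorm_unitary (conjTranspose_unitary hF) hF]
  refine (hsNorm_diagonal_le hl fun m => ?_).trans_eq (by rw [Fintype.card_fin])
  refine (hg _ _).trans ?_
  have hN' : (0 : ℝ) < N := by exact_mod_cast hN
  have h1 : ((m : ℕ) : ℝ) / N ≤ 1 := (div_le_one hN').2 (by exact_mod_cast m.2.le)
  have h2 : 0 ≤ ((m : ℕ) : ℝ) / N := by positivity
  rw [sub_zero, abs_of_nonneg h2]
  nlinarith

lemma bakerMix_commute_indic :
    diagonal (indic (leftHalf (M := M))) * bakerMix (M + M) =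
      bakerMix (M + M) * diagonal (indic leftHalf) := by
  ext i j
  have h : (M + M) / 2 = M := by omega
  rw [diagonal_mul, mul_diagonal]
  simp only [bakerMix, Matrix.of_apply, indic, leftHalf, h]
  rcases lt_or_ge (i : ℕ) M with hi | hi <;> rcases lt_or_ge (j : ℕ) M with hj | hj
  · simp [hi, hj]
  · simp [hi, hj, not_le.2 hi, not_lt.2 hj]
  · simp [hi, hj, not_lt.2 hi, not_le.2 hj]
  · simp [hi, hj, not_lt.2 hi, not_lt.2 hj]

lemma bakerMix_commute_indic_not :
    diagonal (indic fun x => ¬ leftHalf (M := M) x) * bakerMix (M + M) =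
      bakerMix (M + M) * diagonal (indic fun x => ¬ leftHalf x) := by
  ext i j
  have h : (M + M) / 2 = M := by omega
  rw [diagonal_mul, mul_diagonal]
  simp only [bakerMix, Matrix.of_apply, indic, leftHalf, h]
  rcases lt_or_ge (i : ℕ) M with hi | hi <;> rcases lt_or_ge (j : ℕ) M with hj | hj
  · simp [hi, hj]
  · simp [hi, hj, not_le.2 hi, not_lt.2 hj]
  · simp [hi, hj, not_lt.2 hi, not_le.2 hj]
  · simp [hi, hj, not_lt.2 hi, not_lt.2 hj]

/-- The two branches of `g` under the inverse of the doubling map. -/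
def branch (e : ℝ) (g : ℝ → ℂ) (x : ℝ) : ℂ := g ((x + e) / 2)

lemma branch_lipschitz {g : ℝ → ℂ} {l : ℝ} (hg : ∀ x y, ‖g x - g y‖ ≤ l * |x - y|) (e x y : ℝ) :
    ‖branch e g x - branch e g y‖ ≤ l / 2 * |x - y| := by
  refine (hg _ _).trans_eq ?_
  rw [show (x + e) / 2 - (y + e) / 2 = (x - y) / 2 by ring, abs_div, abs_two]
  ring

/-- A point of the circle is half of its double, plus 1/2 exactly when it lies in the right half. -/
lemma diagonal_sample_eq (g : ℝ → ℂ) : diagonal (sample (M + M) g) =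
    diagonal (indic leftHalf) * diagonal (double (sample (M + M) (branch 0 g))) +
      diagonal (indic fun x => ¬ leftHalf x) *
        diagonal (double (sample (M + M) (branch 1 g))) := by
  rw [Matrix.diagonal_mul_diagonal, Matrix.diagonal_mul_diagonal, Matrix.diagonal_add]
  congr 1
  funext x
  have hM : (M : ℝ) ≠ 0 := by exact_mod_cast NeZero.ne M
  have hx := x.2
  by_cases h : (x : ℕ) < M
  · have hv : ((x + x : Fin (M + M)) : ℕ) = x + x := by
      rw [Fin.val_add, Nat.mod_eq_of_lt (by omega)]
    simp only [indic, leftHalf, h, double, sample, branch, hv, if_true, not_true, if_false,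
      one_mul, zero_mul, add_zero]
    congr 1
    push_cast
    field_simp
    ring
  · have hv : ((x + x : Fin (M + M)) : ℕ) + (M + M) = x + x := by
      rw [Fin.val_add, Nat.mod_eq_sub_mod (by omega), Nat.mod_eq_of_lt (by omega)]
      omega
    have hv' : (((x + x : Fin (M + M)) : ℕ) : ℝ) = x + x - (M + M) := by
      rw [eq_sub_iff_add_eq]; exact_mod_cast hv
    simp only [indic, leftHalf, h, double, sample, branch, hv', if_true, not_false_iff, if_false,
      one_mul, zero_mul, zero_add]
    congr 1
    push_cast
    field_simp
    ring

/-- Egorov's theorem for functions of momentum. -/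
lemma hsNorm_evolve_momentumOp_sub_le {g : ℝ → ℂ} (hg1 : ∀ x, ‖g x‖ ≤ 1) {l : ℝ}
    (hg : ∀ x y, ‖g x - g y‖ ≤ l * |x - y|) :
    hsNorm (evolve 1 (momentumOp (M + M) g) -
      (diagonal (indic leftHalf) * momentumOp (M + M) (branch 0 g) +
        diagonal (indic fun x => ¬ leftHalf x) * momentumOp (M + M) (branch 1 g))) ≤
      2 * egorovError (M + M) l := by
  have hF' : dft (M + M) * (dft (M + M))ᴴ = 1 :=
    mul_eq_one_comm.1 (dft_unitary (by have := NeZero.pos M; omega))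
  have hK := bakerMix_unitary (NeZero.pos M)
  have c0 : (bakerMix (M + M))ᴴ * diagonal (indic (leftHalf (M := M))) =
      diagonal (indic leftHalf) * (bakerMix (M + M))ᴴ := by
    have := congrArg Matrix.conjTranspose (bakerMix_commute_indic (M := M))
    rw [Matrix.conjTranspose_mul, Matrix.conjTranspose_mul, Matrix.diagonal_conjTranspose,
      star_indic] at this
    exact this
  have c1 : (bakerMix (M + M))ᴴ * diagonal (indic fun x => ¬ leftHalf (M := M) x) =
      diagonal (indic fun x => ¬ leftHalf x) * (bakerMix (M + M))ᴴ := by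
    have := congrArg Matrix.conjTranspose (bakerMix_commute_indic_not (M := M))
    rw [Matrix.conjTranspose_mul, Matrix.conjTranspose_mul, Matrix.diagonal_conjTranspose,
      star_indic] at this
    exact this
  -- The Fourier matrix diagonalising p̂ cancels the F* in the baker's map, so only the block
  -- diagonal factor conjugates.
  have hev : evolve 1 (momentumOp (M + M) g) =
      (bakerMix (M + M))ᴴ * diagonal (sample (M + M) g) * bakerMix (M + M) := by
    rw [evolve, pow_one, momentumOp, quantumBaker_eq (by have := NeZero.pos M; omega),
      Matrix.conjTranspose_mul, Matrix.conjTranspose_conjTranspose]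
    set F := dft (M + M)
    set K := bakerMix (M + M)
    calc Kᴴ * F * (Fᴴ * diagonal (sample (M + M) g) * F) * (Fᴴ * K)
        = Kᴴ * (F * Fᴴ) * diagonal (sample (M + M) g) * (F * Fᴴ) * K := by
          simp only [Matrix.mul_assoc]
      _ = _ := by rw [hF', Matrix.mul_one, Matrix.mul_one]
  have hE : ∀ e, hsNorm ((bakerMix (M + M))ᴴ * diagonal (double (sample (M + M) (branch e g))) *
      bakerMix (M + M) - momentumOp (M + M) (branch e g)) ≤ egorovError (M + M) l := by
    intro e
    refine (hsNorm_dft_conj_sub_le fun x => hg1 _).trans (egorovError_mono _ ?_)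
    refine (cyclicVar_sample_le (branch_lipschitz hg e)).trans_eq (by ring)
  rw [hev, diagonal_sample_eq]
  set K := bakerMix (M + M)
  set D0 := diagonal (double (sample (M + M) (branch 0 g)))
  set D1 := diagonal (double (sample (M + M) (branch 1 g)))
  set P0 := diagonal (indic (leftHalf (M := M)))
  set P1 := diagonal (indic fun x => ¬ leftHalf (M := M) x)
  have : Kᴴ * (P0 * D0 + P1 * D1) * K - (P0 * momentumOp (M + M) (branch 0 g) +
      P1 * momentumOp (M + M) (branch 1 g)) =
      P0 * (Kᴴ * D0 * K - momentumOp (M + M) (branch 0 g)) +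
        P1 * (Kᴴ * D1 * K - momentumOp (M + M) (branch 1 g)) := by
    rw [Matrix.mul_add, Matrix.add_mul, ← Matrix.mul_assoc, ← Matrix.mul_assoc, c0, c1,
      Matrix.mul_sub, Matrix.mul_sub]
    simp only [Matrix.mul_assoc]
    abel
  rw [this]
  have e0 := (hsNorm_diagonal_mul_le zero_le_one (norm_indic_le (leftHalf (M := M)))
    (Kᴴ * D0 * K - momentumOp (M + M) (branch 0 g)))
  have e1 := (hsNorm_diagonal_mul_le zero_le_one (norm_indic_le fun x => ¬ leftHalf (M := M) x)
    (Kᴴ * D1 * K - momentumOp (M + M) (branch 1 g)))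
  have := hsNorm_add_le (P0 * (Kᴴ * D0 * K - momentumOp (M + M) (branch 0 g)))
    (P1 * (Kᴴ * D1 * K - momentumOp (M + M) (branch 1 g)))
  have h0 := hE 0
  have h1 := hE 1
  linarith

/-- Under the backward evolution a function of momentum becomes nearly diagonal in position. -/
lemma offNorm_evolve_momentumOp_le (T : ℕ) (L : ℝ) {t : ℕ} (ht : t ≤ T) {g : ℝ → ℂ}
    (hg1 : ∀ x, ‖g x‖ ≤ 1) {l : ℝ} (hl : l ≤ L) (hg : ∀ x y, ‖g x - g y‖ ≤ l * |x - y|) :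
    offNorm (evolve t (momentumOp (M + M) g)) ≤
      (Real.sqrt 2 / 2) ^ t * l * Real.sqrt ((M + M : ℕ) : ℝ) +
        4 ^ t * (2 * egorovError (M + M) L + 2 * (T * egorovError (M + M) (4 ^ T * 2))) := by
  set η := 2 * egorovError (M + M) L + 2 * (T * egorovError (M + M) (4 ^ T * 2)) with hη
  have hη0 : 0 ≤ η := by
    have h1 := egorovError_nonneg (M + M) L
    have h2 := egorovError_nonneg (M + M) (4 ^ T * 2)
    positivity
  induction t generalizing g l with
  | zero =>
    rw [evolve_zero, pow_zero, pow_zero, one_mul, one_mul]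
    have := offNorm_momentumOp_le (N := M + M) (by have := NeZero.pos M; omega) hg
    linarith
  | succ t ih =>
    have hl0 : 0 ≤ l := by
      have := (norm_nonneg _).trans (hg 1 0)
      simpa using this
    have hY : ∀ e, offNorm (evolve t (momentumOp (M + M) (branch e g))) ≤ _ := fun e =>
      ih (by omega) (fun x => hg1 _) (show l / 2 ≤ L by linarith) (branch_lipschitz hg e)
    set P0 := diagonal (indic (leftHalf (M := M))) with hP0
    set P1 := diagonal (indic fun x => ¬ leftHalf (M := M) x) with hP1
    set A := P0 * momentumOp (M + M) (branch 0 g) + P1 * momentumOp (M + M) (branch 1 g) with hA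
    have h1 : offNorm (evolve (t + 1) (momentumOp (M + M) g)) ≤
        offNorm (evolve t A) + 2 * egorovError (M + M) l := by
      rw [evolve_succ]
      refine (offNorm_le_add _ (evolve t A)).trans ?_
      rw [← evolve_sub, hsNorm_evolve]
      gcongr
      exact hsNorm_evolve_momentumOp_sub_le hg1 hg
    obtain ⟨s, hs, hs'⟩ := iterate_double_indic (leftHalf (M := M)) t
    have hT : t * egorovError (M + M) (4 ^ t * 2) ≤ T * egorovError (M + M) (4 ^ T * 2) := by
      have h4 : egorovError (M + M) (4 ^ t * 2) ≤ egorovError (M + M) (4 ^ T * 2) := by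
        apply egorovError_mono
        gcongr
        · norm_num
        · omega
      have h5 := egorovError_nonneg (M + M) (4 ^ t * 2)
      have h6 : (t : ℝ) ≤ T := by exact_mod_cast (by omega : t ≤ T)
      gcongr
    have q0 : hsNorm (evolve t P0 - diagonal (indic s)) ≤ T * egorovError (M + M) (4 ^ T * 2) := by
      rw [← hs]
      refine ((hsNorm_evolve_diagonal_sub_iterate_le (norm_indic_le _) t).trans ?_).trans hT
      gcongr
      apply egorovError_mono
      gcongr
      exact cyclicVar_indic_leftHalf_le
    have q1 : hsNorm (evolve t P1 - diagonal (indic fun x => ¬ s x)) ≤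
        T * egorovError (M + M) (4 ^ T * 2) := by
      rw [← hs']
      refine ((hsNorm_evolve_diagonal_sub_iterate_le (norm_indic_le _) t).trans ?_).trans hT
      gcongr
      apply egorovError_mono
      gcongr
      rw [cyclicVar_indic_not]
      exact cyclicVar_indic_leftHalf_le
    set Y0 := evolve t (momentumOp (M + M) (branch 0 g)) with hY0
    set Y1 := evolve t (momentumOp (M + M) (branch 1 g)) with hY1
    have h2 : offNorm (evolve t A) ≤
        offNorm (diagonal (indic s) * Y0 + diagonal (indic fun x => ¬ s x) * Y1) +
          2 * (T * egorovError (M + M) (4 ^ T * 2)) := by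
      refine (offNorm_le_add _ _).trans (add_le_add le_rfl ?_)
      -- Only the indicators are replaced by their classical evolutions. The momentum factors are
      -- kept exact for the induction hypothesis and have operator norm at most 1.
      have : evolve t A - (diagonal (indic s) * Y0 + diagonal (indic fun x => ¬ s x) * Y1) =
          (evolve t P0 - diagonal (indic s)) * Y0 +
            (evolve t P1 - diagonal (indic fun x => ¬ s x)) * Y1 := by
        rw [hA, evolve_add, evolve_mul, evolve_mul, Matrix.sub_mul, Matrix.sub_mul]
        abel
      rw [this]
      refine (hsNorm_add_le _ _).trans ?_
      have r0 := hsNorm_mul_evolve_momentumOp_le (g := branch 0 g) (fun x => hg1 _) t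
        (evolve t P0 - diagonal (indic s))
      have r1 := hsNorm_mul_evolve_momentumOp_le (g := branch 1 g) (fun x => hg1 _) t
        (evolve t P1 - diagonal (indic fun x => ¬ s x))
      linarith
    have h3 := offNorm_indic_add_le s Y0 Y1 (hY 0) (hY 1)
    have h4 : egorovError (M + M) l ≤ egorovError (M + M) L := egorovError_mono _ hl
    -- The new error η and √2 times the old error fit into 4^(t+1) η because √2 + 1 ≤ 4.
    have h5 : Real.sqrt 2 ≤ 3 := by
      rw [Real.sqrt_le_left (by norm_num)]; norm_num
    have h6 : Real.sqrt 2 * (4 ^ t * η) ≤ 3 * (4 ^ t * η) := by gcongr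
    have h7 : η ≤ 4 ^ t * η := le_mul_of_one_le_left hη0 (one_le_pow₀ (by norm_num))
    -- The loss √2 from recombining branches against the halved Lipschitz constant: a net factor
    -- √2/2 < 1.
    have h8 : Real.sqrt 2 * ((Real.sqrt 2 / 2) ^ t * (l / 2) * Real.sqrt ((M + M : ℕ) : ℝ)) =
        (Real.sqrt 2 / 2) ^ (t + 1) * l * Real.sqrt ((M + M : ℕ) : ℝ) := by
      rw [pow_succ]; ring
    rw [mul_add, h8] at h3
    rw [pow_succ 4]
    linarith

end Evolution

/-! ### Quantum translations as products of position and momentum characters. -/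

lemma momentumOp_circ_apply {N : ℕ} (hN : 0 < N) (k : ℤ) (i j : Fin N) :
    momentumOp N (fun x => circ (-(k * x))) i j =
      if ((i : ℕ) : ℤ) ≡ ((j : ℕ) : ℤ) + k [ZMOD (N : ℤ)] then 1 else 0 := by
  have hN' : (N : ℝ) ≠ 0 := by exact_mod_cast hN.ne'
  have hNc : (N : ℂ) ≠ 0 := by exact_mod_cast hN.ne'
  rw [momentumOp, dft_conj_diagonal_apply]
  have h := sum_circ N hN ((i : ℕ) - (j : ℕ) - k : ℤ)
  have h1 : ∀ m : Fin N, sample N (fun x => circ (-(k * x))) m *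
      circ ((m : ℕ) * ((((i : ℕ) : ℝ) - (j : ℕ)) / N)) =
      circ ((m : ℕ) * ((((i : ℕ) - (j : ℕ) - k : ℤ) : ℝ) / N)) := by
    intro m
    rw [sample, ← circ_add]
    congr 1
    push_cast
    ring
  simp only [h1, h]
  have hiff : ((N : ℤ) ∣ ((i : ℕ) - (j : ℕ) - k : ℤ)) ↔
      ((i : ℕ) : ℤ) ≡ ((j : ℕ) : ℤ) + k [ZMOD (N : ℤ)] := by
    rw [Int.modEq_iff_dvd, dvd_sub_comm,
      show k - (((i : ℕ) : ℤ) - (j : ℕ)) = (j : ℕ) + k - (i : ℕ) by ring]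
  simp only [hiff]
  split_ifs
  · field_simp
  · simp

/-- The phase of a quantum translation. -/
def weylPhase (N : ℕ) (k : ℤ × ℤ) : ℂ := circ (-(k.1 * k.2 / (2 * N)))

lemma norm_weylPhase (N : ℕ) (k : ℤ × ℤ) : ‖weylPhase N k‖ = 1 := norm_circ _

lemma translation_eq {N : ℕ} (hN : 0 < N) (k : ℤ × ℤ) :
    translation N k = diagonal (sample N fun x => weylPhase N k * circ (k.2 * x)) *
      momentumOp N (fun x => circ (-(k.1 * x))) := by
  ext i j
  rw [diagonal_mul, momentumOp_circ_apply hN, translation, Matrix.of_apply]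
  split_ifs
  · rw [mul_one, sample, weylPhase, circ, circ]
    congr 2
    · push_cast; ring
    · push_cast; ring
  · simp

lemma hsNorm_translation_le {N : ℕ} (hN : 0 < N) (k : ℤ × ℤ) :
    hsNorm (translation N k) ≤ Real.sqrt N := by
  have hF := dft_unitary hN
  rw [translation_eq hN]
  refine (hsNorm_diagonal_mul_le zero_le_one (fun i => ?_) _).trans ?_
  · rw [sample, norm_mul, norm_weylPhase, norm_circ, one_mul]
  · rw [one_mul, momentumOp, hsNorm_unitary (conjTranspose_unitary hF) hF]
    refine (hsNorm_diagonal_le zero_le_one fun i => ?_).trans_eq ?_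
    · exact (norm_circ _).le
    · rw [one_mul, Fintype.card_fin]

lemma circ_mul_lipschitz (c : ℂ) (hc : ‖c‖ = 1) (k : ℝ) (x y : ℝ) :
    ‖c * circ (k * x) - c * circ (k * y)‖ ≤ 2 * Real.pi * |k| * |x - y| := by
  rw [← mul_sub, norm_mul, hc, one_mul]
  refine (norm_circ_sub_le _ _).trans_eq ?_
  rw [← mul_sub, abs_mul]; ring

/-! ### Decay of autocorrelations of quantum translations. -/

section Correlation

variable {M : ℕ} [NeZero M]

lemma double_sample_circ (c : ℂ) (k : ℤ) :
    double (sample (M + M) fun x => c * circ (k * x)) =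
      sample (M + M) fun x => c * circ ((2 * k : ℤ) * x) := by
  have hM : (M : ℝ) ≠ 0 := by exact_mod_cast NeZero.ne M
  funext x
  have hx := x.2
  simp only [double, sample]
  congr 1
  by_cases h : (x : ℕ) < M
  · have hv : ((x + x : Fin (M + M)) : ℕ) = x + x := by
      rw [Fin.val_add, Nat.mod_eq_of_lt (by omega)]
    rw [hv]
    congr 1
    push_cast
    ring
  · have hv : ((x + x : Fin (M + M)) : ℕ) + (M + M) = x + x := by
      rw [Fin.val_add, Nat.mod_eq_sub_mod (by omega), Nat.mod_eq_of_lt (by omega)]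
      omega
    have hv' : (((x + x : Fin (M + M)) : ℕ) : ℝ) = x + x - (M + M) := by
      rw [eq_sub_iff_add_eq]; exact_mod_cast hv
    rw [hv', ← circ_add_intCast _ k]
    congr 1
    push_cast
    field_simp
    ring

lemma iterate_double_sample_circ (c : ℂ) (k : ℤ) (t : ℕ) :
    double^[t] (sample (M + M) fun x => c * circ (k * x)) =
      sample (M + M) fun x => c * circ ((2 ^ t * k : ℤ) * x) := by
  induction t generalizing k with
  | zero => simp
  | succ t ih =>
    rw [Function.iterate_succ_apply, double_sample_circ, ih, pow_succ, mul_assoc]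

lemma hsInner_diagonal {n : Type*} [Fintype n] [DecidableEq n] (u v : n → ℂ) :
    hsInner (diagonal u) (diagonal v) = ∑ i, conj (u i) * v i := by
  rw [hsInner_eq_trace, Matrix.diagonal_conjTranspose, Matrix.diagonal_mul_diagonal,
    Matrix.trace_diagonal]
  rfl

lemma hsInner_diagonal_sample_circ {N : ℕ} (hN : 0 < N) (c : ℂ) {k l : ℤ}
    (h : ¬ (N : ℤ) ∣ l - k) :
    hsInner (diagonal (sample N fun x => c * circ (k * x)))
      (diagonal (sample N fun x => c * circ (l * x))) = 0 := by
  rw [hsInner_diagonal]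
  have : ∀ i : Fin N, conj (sample N (fun x => c * circ (k * x)) i) *
      sample N (fun x => c * circ (l * x)) i =
      conj c * c * circ ((i : ℕ) * (((l - k : ℤ) : ℝ) / N)) := by
    intro i
    rw [sample, sample, map_mul, conj_circ]
    rw [show ((i : ℕ) : ℝ) * (((l - k : ℤ) : ℝ) / N) =
      -(k * ((i : ℕ) / N)) + l * ((i : ℕ) / N) by push_cast; ring, circ_add]
    ring
  rw [sum_congr rfl fun i _ => this i, ← mul_sum, sum_circ N hN, if_neg h, mul_zero]

/-- The bound for the autocorrelation at time `r` of a quantum translation. -/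
def correlationBound (N T : ℕ) (k : ℤ × ℤ) (r : ℕ) : ℝ :=
  (Real.sqrt 2 / 2) ^ r * (2 * Real.pi * |(k.1 : ℝ)|) * Real.sqrt N +
    4 ^ r * (2 * egorovError N (2 * Real.pi * |(k.1 : ℝ)|) + 2 * (T * egorovError N (4 ^ T * 2))) +
    r * egorovError N (4 ^ r * (2 * (2 * Real.pi * |(k.2 : ℝ)|)))

/-- Decay of the autocorrelations of a quantum translation. -/
lemma norm_hsInner_translation_evolve_le {k : ℤ × ℤ} (hk : k ≠ 0) {T r : ℕ} (hr : r ≠ 0)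
    (hrT : r ≤ T) (h1 : |k.1| < ((M + M : ℕ) : ℤ)) (h2 : |k.2| * 2 ^ T < ((M + M : ℕ) : ℤ)) :
    ‖hsInner (translation (M + M) k) (evolve r (translation (M + M) k))‖ ≤
      Real.sqrt ((M + M : ℕ) : ℝ) * correlationBound (M + M) T k r := by
  have hN : 0 < M + M := by have := NeZero.pos M; omega
  set u := sample (M + M) fun x => weylPhase (M + M) k * circ (k.2 * x) with hu
  set P := momentumOp (M + M) (fun x => circ (-(k.1 * x))) with hP
  have hT : translation (M + M) k = diagonal u * P := translation_eq hN k
  have hu1 : ∀ x, ‖u x‖ ≤ 1 := fun x => by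
    rw [hu, sample, norm_mul, norm_weylPhase, norm_circ, one_mul]
  have hVu : cyclicVar u ≤ 2 * (2 * Real.pi * |(k.2 : ℝ)|) :=
    cyclicVar_sample_le (circ_mul_lipschitz _ (norm_weylPhase _ _) _)
  have hE : hsNorm (evolve r (diagonal u) - diagonal (double^[r] u)) ≤
      r * egorovError (M + M) (4 ^ r * (2 * (2 * Real.pi * |(k.2 : ℝ)|))) := by
    refine (hsNorm_evolve_diagonal_sub_iterate_le hu1 r).trans ?_
    gcongr
    apply egorovError_mono
    gcongr
  have hg1 : ∀ x : ℝ, ‖circ (-(k.1 * x))‖ ≤ 1 := fun x => (norm_circ _).le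
  have e1 := egorovError_nonneg (M + M) (2 * Real.pi * |(k.1 : ℝ)|)
  have e2 := egorovError_nonneg (M + M) (4 ^ T * 2)
  have hTn := hsNorm_translation_le hN k
  have hT0 := hsNorm_nonneg (translation (M + M) k)
  have hbound : hsNorm (translation (M + M) k) *
      hsNorm ((evolve r (diagonal u) - diagonal (double^[r] u)) * evolve r P) ≤
      Real.sqrt ((M + M : ℕ) : ℝ) *
        (r * egorovError (M + M) (4 ^ r * (2 * (2 * Real.pi * |(k.2 : ℝ)|)))) := by
    gcongr
    · exact hsNorm_nonneg _
    · exact (hsNorm_mul_evolve_momentumOp_le hg1 r _).trans hE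
  have hdec : evolve r (translation (M + M) k) = diagonal (double^[r] u) * evolve r P +
      (evolve r (diagonal u) - diagonal (double^[r] u)) * evolve r P := by
    rw [hT, evolve_mul, Matrix.sub_mul]; abel
  by_cases hk1 : k.1 = 0
  · have hP1 : P = 1 := by
      have : sample (M + M) (fun x => circ (-((k.1 : ℝ) * x))) = fun _ => 1 := by
        funext x; simp [sample, hk1, circ_zero]
      rw [hP, momentumOp, this, Matrix.diagonal_one, Matrix.mul_one, dft_unitary hN]
    have hk2 : k.2 ≠ 0 := fun h => hk (Prod.ext hk1 h)
    have hev1 : evolve r P = 1 := by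
      rw [hP1, evolve, Matrix.mul_one, quantumBaker_pow_unitary]
    -- The frequencies k₂ and 2^r k₂ differ by (2^r - 1)k₂, which is nonzero as r ≥ 1 and too small
    -- to be a multiple of N.
    have hzero : hsInner (translation (M + M) k) (diagonal (double^[r] u) * evolve r P) = 0 := by
      rw [hev1, hT, hP1, Matrix.mul_one, Matrix.mul_one, hu, iterate_double_sample_circ]
      apply hsInner_diagonal_sample_circ hN
      intro hdvd
      have hpow : (2 : ℤ) ≤ 2 ^ r := by
        calc (2 : ℤ) = 2 ^ 1 := by norm_num
          _ ≤ 2 ^ r := pow_le_pow_right₀ (by norm_num) (by omega)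
      have hpow' : (2 : ℤ) ^ r ≤ 2 ^ T := pow_le_pow_right₀ (by norm_num) hrT
      have habs : |2 ^ r * k.2 - k.2| = (2 ^ r - 1) * |k.2| := by
        rw [show 2 ^ r * k.2 - k.2 = (2 ^ r - 1) * k.2 by ring, abs_mul,
          abs_of_nonneg (by linarith : (0 : ℤ) ≤ 2 ^ r - 1)]
      have hk2' : 0 < |k.2| := abs_pos.2 hk2
      have := Int.eq_zero_of_abs_lt_dvd hdvd (by rw [habs]; nlinarith)
      rw [this, abs_zero] at habs
      nlinarith
    have : hsInner (translation (M + M) k) (evolve r (translation (M + M) k)) =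
        hsInner (translation (M + M) k)
          ((evolve r (diagonal u) - diagonal (double^[r] u)) * evolve r P) := by
      rw [hdec, hsInner, map_add, inner_add_right]
      change hsInner _ _ + hsInner _ _ = _
      rw [hzero, zero_add]
    rw [this]
    refine ((norm_hsInner_le _ _).trans hbound).trans ?_
    gcongr
    rw [correlationBound]
    have : 0 ≤ (Real.sqrt 2 / 2) ^ r * (2 * Real.pi * |(k.1 : ℝ)|) *
        Real.sqrt ((M + M : ℕ) : ℝ) := by positivity
    have : 0 ≤ 4 ^ r * (2 * egorovError (M + M) (2 * Real.pi * |(k.1 : ℝ)|) +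
      2 * (T * egorovError (M + M) (4 ^ T * 2))) := by positivity
    linarith
  · have hdiag : ∀ i, translation (M + M) k i i = 0 := by
      intro i
      rw [translation, Matrix.of_apply, if_neg]
      intro h
      rw [Int.modEq_iff_dvd, add_sub_cancel_left] at h
      exact hk1 (Int.eq_zero_of_abs_lt_dvd h h1)
    refine (norm_hsInner_le_offNorm hdiag _).trans ?_
    have hoff : offNorm (evolve r (translation (M + M) k)) ≤ correlationBound (M + M) T k r := by
      rw [hdec, correlationBound]
      refine (offNorm_add_le _ _).trans (add_le_add ?_ ?_)
      · refine (offNorm_diagonal_mul_le zero_le_one (norm_iterate_double_le hu1 r) _).trans ?_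
        rw [one_mul]
        refine offNorm_evolve_momentumOp_le T (2 * Real.pi * |(k.1 : ℝ)|) hrT hg1 le_rfl ?_
        intro x y
        have := circ_mul_lipschitz 1 norm_one (-(k.1 : ℝ)) x y
        simpa only [one_mul, abs_neg, neg_mul] using this
      · exact (offNorm_le_hsNorm _).trans ((hsNorm_mul_evolve_momentumOp_le hg1 r _).trans hE)
    exact mul_le_mul hTn hoff (offNorm_nonneg _) (Real.sqrt_nonneg _)

end Correlation

/-! ### Almost orthogonality and the numerical bounds at logarithmic times. -/

/-- Summing almost orthogonal vectors. -/
lemma norm_sum_range_sq_le {E : Type*} [NormedAddCommGroup E] [InnerProductSpace ℂ E] (v : ℕ → E)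
    (c : ℕ → ℝ) (hc : ∀ r, 0 ≤ c r) (T : ℕ)
    (hv : ∀ s r, r ≤ T → ‖inner ℂ (v s) (v (s + r))‖ ≤ c r) :
    ‖∑ t ∈ range (T + 1), v t‖ ^ 2 ≤ (T + 1) * (c 0 + 2 * ∑ j ∈ range T, c (j + 1)) := by
  have key : ∀ n ≤ T + 1, ‖∑ t ∈ range n, v t‖ ^ 2 ≤
      n * (c 0 + 2 * ∑ j ∈ range T, c (j + 1)) := by
    intro n
    induction n with
    | zero => simp
    | succ n ih =>
      intro hn
      have h := ih (by omega)
      rw [sum_range_succ, @norm_add_sq ℂ]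
      have h1 : RCLike.re (inner ℂ (∑ t ∈ range n, v t) (v n)) ≤ ∑ j ∈ range T, c (j + 1) := by
        refine (RCLike.re_le_norm _).trans ?_
        rw [sum_inner]
        refine (norm_sum_le _ _).trans ?_
        calc ∑ s ∈ range n, ‖inner ℂ (v s) (v n)‖ ≤ ∑ s ∈ range n, c (n - 1 - s + 1) := by
              refine sum_le_sum fun s hs => ?_
              rw [mem_range] at hs
              have := hv s (n - 1 - s + 1) (by omega)
              rwa [show s + (n - 1 - s + 1) = n by omega] at this
          _ = ∑ j ∈ range n, c (j + 1) := sum_range_reflect (fun j => c (j + 1)) n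
          _ ≤ _ := sum_le_sum_of_subset_of_nonneg (range_subset_range.2 (by omega))
              fun _ _ _ => hc _
      have h2 : ‖v n‖ ^ 2 ≤ c 0 := by
        have := hv n 0 (by omega)
        rw [add_zero, inner_self_eq_norm_sq_to_K] at this
        simpa using this
      push_cast
      linarith
  have := key (T + 1) le_rfl
  push_cast at this
  exact this

lemma two_pow_le_sqrt_sqrt {N T : ℕ} (h : 2 ^ (40 * T) ≤ N) :
    ((2 : ℝ) ^ T) ^ 10 ≤ Real.sqrt (Real.sqrt N) := by
  apply Real.le_sqrt_of_sq_le
  apply Real.le_sqrt_of_sq_le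
  rw [← pow_mul, ← pow_mul, ← pow_mul, show T * (10 * 2 * 2) = 40 * T by ring]
  exact_mod_cast h

/-- Write N^{1/4} as √N / N^{1/4}. The exponent 40 makes the denominator at least ten powers of 2^T,
a budget for all factors exponential in T. -/
lemma egorovError_le {N T : ℕ} (h : 2 ^ (40 * T) ≤ N) {V W : ℝ} (hVW : Real.sqrt V ≤ W) :
    egorovError N V ≤ 4 * W * (Real.sqrt N / ((2 : ℝ) ^ T) ^ 10) := by
  have h1 := two_pow_le_sqrt_sqrt h
  set s := Real.sqrt (Real.sqrt N) with hs
  have hs2 : Real.sqrt N = s * s := by rw [hs, Real.mul_self_sqrt (Real.sqrt_nonneg _)]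
  have hX : (0 : ℝ) < ((2 : ℝ) ^ T) ^ 10 := by positivity
  have hs0 : 0 ≤ s := Real.sqrt_nonneg _
  rw [egorovError, ← hs, hs2]
  have h2 : s ≤ s * s / ((2 : ℝ) ^ T) ^ 10 := by
    rw [le_div_iff₀ hX]
    gcongr
  have hW : 0 ≤ W := (Real.sqrt_nonneg _).trans hVW
  gcongr

lemma sqrt_le_one_add {x : ℝ} (hx : 0 ≤ x) : Real.sqrt x ≤ 1 + x := by
  rw [Real.sqrt_le_left (by linarith)]
  nlinarith

/-- In units of X = 2^T, the losses 4^r ≤ X², T ≤ X and √(4^T · 2) ≤ 2X amount to at most X⁴, well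
within the gain X^10. One factor 1/X is kept for the sum over r. -/
lemma correlationBound_le {N T : ℕ} (h : 2 ^ (40 * T) ≤ N) (k : ℤ × ℤ) {r : ℕ} (hr : r ≤ T) :
    correlationBound N T k r ≤ (3 / 4) ^ r * (2 * Real.pi * |(k.1 : ℝ)|) * Real.sqrt N +
      (28 + 8 * (2 * Real.pi * |(k.1 : ℝ)|) + 8 * (2 * Real.pi * |(k.2 : ℝ)|)) *
        (Real.sqrt N / 2 ^ T) := by
  set X : ℝ := 2 ^ T with hX
  set a := 2 * Real.pi * |(k.1 : ℝ)| with ha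
  set b := 2 * Real.pi * |(k.2 : ℝ)| with hb
  have ha0 : 0 ≤ a := by positivity
  have hb0 : 0 ≤ b := by positivity
  have hX1 : 1 ≤ X := one_le_pow₀ (by norm_num)
  have hX0 : 0 < X := by linarith
  have hTX : (T : ℝ) ≤ X := by
    have := (Nat.lt_two_pow_self (n := T)).le
    rw [hX]; exact_mod_cast this
  have hrX : (r : ℝ) ≤ X := le_trans (by exact_mod_cast hr) hTX
  have h4T : (4 : ℝ) ^ T = X ^ 2 := by rw [hX, ← pow_mul, mul_comm, pow_mul]; norm_num
  have h4r : (4 : ℝ) ^ r ≤ X ^ 2 := by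
    rw [← h4T]; exact pow_le_pow_right₀ (by norm_num) hr
  set n := Real.sqrt N with hn
  have hn0 : 0 ≤ n := Real.sqrt_nonneg _
  have s1 := egorovError_le h (sqrt_le_one_add ha0)
  have s2 : egorovError N (4 ^ T * 2) ≤ 4 * (2 * X) * (n / X ^ 10) := by
    apply egorovError_le h
    rw [Real.sqrt_le_left (by positivity), h4T]
    nlinarith
  have s3 : egorovError N (4 ^ r * (2 * b)) ≤ 4 * (X * (1 + 2 * b)) * (n / X ^ 10) := by
    apply egorovError_le h
    have := sqrt_le_one_add (x := 2 * b) (by positivity)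
    calc Real.sqrt (4 ^ r * (2 * b)) ≤ Real.sqrt (X ^ 2 * (2 * b)) := by gcongr
      _ = X * Real.sqrt (2 * b) := by
        rw [Real.sqrt_mul (by positivity), Real.sqrt_sq hX0.le]
      _ ≤ _ := by gcongr
  rw [← hX, ← hn] at s1
  have hq : Real.sqrt 2 / 2 ≤ 3 / 4 := by
    have : Real.sqrt 2 ≤ 3 / 2 := by rw [Real.sqrt_le_left (by norm_num)]; norm_num
    linarith
  have hZ : ∀ m ≤ 9, X ^ m * (n / X ^ 10) ≤ n / X := by
    intro m hm
    rw [← mul_div_assoc, div_le_div_iff₀ (by positivity) hX0]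
    have : X ^ m * X ≤ X ^ 10 := by
      rw [← pow_succ]; exact pow_le_pow_right₀ hX1 (by omega)
    calc X ^ m * n * X = n * (X ^ m * X) := by ring
      _ ≤ n * X ^ 10 := by gcongr
  have t1 : (Real.sqrt 2 / 2) ^ r * a * n ≤ (3 / 4) ^ r * a * n := by gcongr
  have e2 := egorovError_nonneg N (4 ^ T * 2)
  have t2 : 4 ^ r * (2 * egorovError N a + 2 * (T * egorovError N (4 ^ T * 2))) ≤
      (24 + 8 * a) * (n / X) := by
    calc _ ≤ X ^ 2 * (2 * (4 * (1 + a) * (n / X ^ 10)) + 2 * (X * (4 * (2 * X) * (n / X ^ 10)))) := by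
          have e1 := egorovError_nonneg N a
          gcongr
      _ = 8 * (1 + a) * (X ^ 2 * (n / X ^ 10)) + 16 * (X ^ 4 * (n / X ^ 10)) := by ring
      _ ≤ 8 * (1 + a) * (n / X) + 16 * (n / X) := by
          gcongr
          · exact hZ 2 (by norm_num)
          · exact hZ 4 (by norm_num)
      _ = _ := by ring
  have t3 : r * egorovError N (4 ^ r * (2 * b)) ≤ (4 + 8 * b) * (n / X) := by
    calc _ ≤ X * (4 * (X * (1 + 2 * b)) * (n / X ^ 10)) := by
          have e1 := egorovError_nonneg N (4 ^ r * (2 * b))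
          gcongr
      _ = (4 + 8 * b) * (X ^ 2 * (n / X ^ 10)) := by ring
      _ ≤ _ := by
          gcongr
          exact hZ 2 (by norm_num)
  rw [correlationBound]
  linarith

lemma sum_correlationBound_le {N T : ℕ} (h : 2 ^ (40 * T) ≤ N) (k : ℤ × ℤ) :
    ∑ j ∈ range T, correlationBound N T k (j + 1) ≤
      100 * (1 + |(k.1 : ℝ)| + |(k.2 : ℝ)|) * Real.sqrt N := by
  have hn0 : 0 ≤ Real.sqrt N := Real.sqrt_nonneg _
  have hgeom : ∑ j ∈ range T, ((3 : ℝ) / 4) ^ (j + 1) ≤ 3 := by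
    have h1 : ∑ j ∈ range T, ((3 : ℝ) / 4) ^ (j + 1) = 3 - 3 * (3 / 4) ^ T := by
      induction T with
      | zero => simp
      | succ T ih =>
        rw [sum_range_succ, ih ((Nat.pow_le_pow_right (by norm_num) (by omega)).trans h)]
        ring
    have h2 : (0 : ℝ) ≤ 3 * (3 / 4) ^ T := by positivity
    linarith
  have hT : (T : ℝ) * (Real.sqrt N / 2 ^ T) ≤ Real.sqrt N := by
    have : (T : ℝ) ≤ 2 ^ T := by exact_mod_cast (Nat.lt_two_pow_self (n := T)).le
    rw [← mul_div_assoc, div_le_iff₀ (by positivity), mul_comm]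
    gcongr
  set a := 2 * Real.pi * |(k.1 : ℝ)| with ha
  set b := 2 * Real.pi * |(k.2 : ℝ)| with hb
  have ha0 : 0 ≤ a := by positivity
  have hb0 : 0 ≤ b := by positivity
  calc _ ≤ ∑ j ∈ range T, ((3 / 4) ^ (j + 1) * a * Real.sqrt N +
        (28 + 8 * a + 8 * b) * (Real.sqrt N / 2 ^ T)) :=
        sum_le_sum fun j hj => correlationBound_le h k (by rw [mem_range] at hj; omega)
    _ = (∑ j ∈ range T, ((3 : ℝ) / 4) ^ (j + 1)) * (a * Real.sqrt N) +
        (28 + 8 * a + 8 * b) * (T * (Real.sqrt N / 2 ^ T)) := by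
        rw [sum_add_distrib, sum_const, card_range, nsmul_eq_mul, sum_mul]
        congr 1
        · exact sum_congr rfl fun j _ => by ring
        · ring
    _ ≤ 3 * (a * Real.sqrt N) + (28 + 8 * a + 8 * b) * Real.sqrt N := by gcongr
    _ = (28 + 11 * a + 8 * b) * Real.sqrt N := by ring
    _ ≤ _ := by
        gcongr
        have hpi := Real.pi_lt_d2
        have hk1 := abs_nonneg (k.1 : ℝ)
        have hk2 := abs_nonneg (k.2 : ℝ)
        rw [ha, hb]
        nlinarith

/-! ### Expectation values in an orthonormal basis. -/

section Expectation

variable {N : ℕ}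

lemma op_mul_apply (A B : Matrix (Fin N) (Fin N) ℂ) (v : StateSpace N) :
    op (A * B) v = op A (op B v) := by
  rw [op, Matrix.toLpLin_mul_same]; rfl

lemma inner_op_conjTranspose_mul (A B : Matrix (Fin N) (Fin N) ℂ) (v : StateSpace N) :
    inner ℂ v (op (Aᴴ * B) v) = inner ℂ (op A v) (op B v) := by
  rw [op_mul_apply, op, Matrix.toEuclideanLin_conjTranspose_eq_adjoint,
    LinearMap.adjoint_inner_right]

/-- The vector of expectation values of an operator in an orthonormal basis. -/
def expectVec (φ : OrthonormalBasis (Fin N) ℂ (StateSpace N)) :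
    Matrix (Fin N) (Fin N) ℂ →ₗ[ℂ] StateSpace N where
  toFun X := WithLp.toLp 2 fun j => inner ℂ (φ j) (op X (φ j))
  map_add' X Y := by
    ext j
    simp [op]
  map_smul' c X := by
    ext j
    simp [op]

lemma norm_expectVec_sq (φ : OrthonormalBasis (Fin N) ℂ (StateSpace N))
    (X : Matrix (Fin N) (Fin N) ℂ) :
    ‖expectVec φ X‖ ^ 2 = ∑ j, ‖(inner ℂ (φ j) (op X (φ j)) : ℂ)‖ ^ 2 := by
  rw [EuclideanSpace.norm_sq_eq]; rfl

/-- Diagonal entries in any orthonormal basis carry at most the Hilbert–Schmidt norm: Cauchy–Schwarz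
bounds them by ‖Xφ_j‖, and Parseval is applied to each row. -/
lemma norm_expectVec_le (φ : OrthonormalBasis (Fin N) ℂ (StateSpace N))
    (X : Matrix (Fin N) (Fin N) ℂ) : ‖expectVec φ X‖ ≤ hsNorm X := by
  refine (sq_le_sq₀ (norm_nonneg _) (hsNorm_nonneg X)).1 ?_
  rw [norm_expectVec_sq, hsNorm_sq]
  calc ∑ j, ‖(inner ℂ (φ j) (op X (φ j)) : ℂ)‖ ^ 2 ≤ ∑ j, ‖op X (φ j)‖ ^ 2 := by
        refine sum_le_sum fun j _ => ?_
        have := norm_inner_le_norm (𝕜 := ℂ) (φ j) (op X (φ j))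
        rw [φ.norm_eq_one, one_mul] at this
        gcongr
    _ = ∑ j, ∑ i, ‖(inner ℂ (φ j) (WithLp.toLp 2 fun l => conj (X i l)) : ℂ)‖ ^ 2 := by
        refine sum_congr rfl fun j _ => ?_
        rw [EuclideanSpace.norm_sq_eq]
        refine sum_congr rfl fun i _ => ?_
        rw [← norm_inner_symm]
        congr 2
        rw [Matrix.toLpLin_apply, PiLp.inner_apply]
        simp [Matrix.mulVec, dotProduct, mul_comm]
    _ = ∑ i, ‖(WithLp.toLp 2 fun l => conj (X i l) : StateSpace N)‖ ^ 2 := by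
        rw [sum_comm]
        exact sum_congr rfl fun i _ => φ.sum_sq_norm_inner_right _
    _ = _ := by
        refine sum_congr rfl fun i _ => ?_
        rw [EuclideanSpace.norm_sq_eq]
        simp

lemma inner_op_conj_of_eigenvector {U : Matrix (Fin N) (Fin N) ℂ} (hU : Uᴴ * U = 1)
    (X : Matrix (Fin N) (Fin N) ℂ) {v : StateSpace N} (hv : v ≠ 0) {μ : ℂ} (h : op U v = μ • v) :
    inner ℂ v (op (Uᴴ * X * U) v) = inner ℂ v (op X v) := by
  have key : ∀ Y : Matrix (Fin N) (Fin N) ℂ,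
      inner ℂ v (op (Uᴴ * Y * U) v) = conj μ * μ * inner ℂ v (op Y v) := by
    intro Y
    rw [Matrix.mul_assoc, inner_op_conjTranspose_mul, op_mul_apply, h, map_smul, inner_smul_left,
      inner_smul_right, mul_assoc]
  -- Testing on the identity shows that an eigenvalue of a unitary has modulus 1.
  have h1 := key 1
  rw [Matrix.mul_one, hU] at h1
  have hop : op (1 : Matrix (Fin N) (Fin N) ℂ) v = v := by
    rw [op, Matrix.toLpLin_one]; rfl
  rw [hop] at h1
  have hne : (inner ℂ v v : ℂ) ≠ 0 := inner_self_ne_zero.2 hv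
  have hμ : conj μ * μ = 1 := by
    apply mul_right_cancel₀ hne
    rw [← h1, one_mul]
  rw [key, hμ, one_mul]

lemma op_pow_of_eigenvector {U : Matrix (Fin N) (Fin N) ℂ} {v : StateSpace N} {μ : ℂ}
    (h : op U v = μ • v) (t : ℕ) : op (U ^ t) v = μ ^ t • v := by
  induction t with
  | zero =>
    rw [pow_zero, pow_zero, one_smul, op, Matrix.toLpLin_one]; rfl
  | succ t ih => rw [pow_succ, op_mul_apply, h, map_smul, ih, smul_smul, pow_succ, mul_comm]

end Expectation

/-! ### Time averaging and the variance of one translation. -/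

section Variance

variable {M : ℕ} [NeZero M]

lemma expectVec_evolve {φ : OrthonormalBasis (Fin (M + M)) ℂ (StateSpace (M + M))}
    (hφ : IsBakerEigenbasis φ) (t : ℕ) (X : Matrix (Fin (M + M)) (Fin (M + M)) ℂ) :
    expectVec φ (evolve t X) = expectVec φ X := by
  ext j
  obtain ⟨μ, hμ⟩ := hφ j
  exact inner_op_conj_of_eigenvector (quantumBaker_pow_unitary t) X
    (norm_ne_zero_iff.1 (by rw [φ.norm_eq_one]; norm_num)) (op_pow_of_eigenvector hμ t)

/-- Expectation values are controlled by time averages of autocorrelations. -/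
lemma norm_expectVec_sq_le {φ : OrthonormalBasis (Fin (M + M)) ℂ (StateSpace (M + M))}
    (hφ : IsBakerEigenbasis φ) (X : Matrix (Fin (M + M)) (Fin (M + M)) ℂ) (c : ℕ → ℝ)
    (hc0 : ∀ r, 0 ≤ c r) (T : ℕ) (hc : ∀ r ≤ T, ‖hsInner X (evolve r X)‖ ≤ c r) :
    ‖expectVec φ X‖ ^ 2 ≤ (c 0 + 2 * ∑ j ∈ range T, c (j + 1)) / (T + 1) := by
  have h := norm_sum_range_sq_le (fun t => hsVec (evolve t X)) c hc0 T (by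
    intro s r hr
    change ‖hsInner (evolve s X) (evolve (s + r) X)‖ ≤ c r
    rw [evolve_add_time, hsInner_evolve]
    exact hc r hr)
  rw [← map_sum] at h
  have h1 := norm_expectVec_le φ (∑ t ∈ range (T + 1), evolve t X)
  rw [map_sum, sum_congr rfl fun t _ => expectVec_evolve hφ t X, sum_const, card_range,
    ← Nat.cast_smul_eq_nsmul ℂ, norm_smul, Complex.norm_natCast] at h1
  have h2 := (pow_le_pow_left₀ (by positivity) h1 2).trans h
  rw [mul_pow] at h2
  have hT : (0 : ℝ) < T + 1 := by positivity
  rw [le_div_iff₀ hT]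
  push_cast at h2
  have h3 : (T + 1 : ℝ) * (‖expectVec φ X‖ ^ 2 * (T + 1)) ≤
      (T + 1) * (c 0 + 2 * ∑ j ∈ range T, c (j + 1)) := by
    calc _ = (T + 1 : ℝ) ^ 2 * ‖expectVec φ X‖ ^ 2 := by ring
      _ ≤ _ := h2
  exact le_of_mul_le_mul_left h3 hT

lemma correlationBound_nonneg (N T : ℕ) (k : ℤ × ℤ) (r : ℕ) : 0 ≤ correlationBound N T k r := by
  have e1 := egorovError_nonneg N (2 * Real.pi * |(k.1 : ℝ)|)
  have e2 := egorovError_nonneg N (4 ^ T * 2)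
  have e3 := egorovError_nonneg N (4 ^ r * (2 * (2 * Real.pi * |(k.2 : ℝ)|)))
  unfold correlationBound
  positivity

/-- The quantum variance of a single quantum translation. -/
lemma norm_expectVec_translation_sq_le
    {φ : OrthonormalBasis (Fin (M + M)) ℂ (StateSpace (M + M))} (hφ : IsBakerEigenbasis φ)
    {T : ℕ} (hT : 2 ^ (40 * T) ≤ M + M) {k : ℤ × ℤ} (hk : k ≠ 0) :
    ‖expectVec φ (translation (M + M) k)‖ ^ 2 ≤
      201 * (1 + |(k.1 : ℝ)| + |(k.2 : ℝ)|) * ((M + M : ℕ) : ℝ) / (T + 1) := by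
  have hN : 0 < M + M := by have := NeZero.pos M; omega
  have hn := Real.mul_self_sqrt (Nat.cast_nonneg (α := ℝ) (M + M))
  have hTn := hsNorm_translation_le hN k
  have hk1 := abs_nonneg (k.1 : ℝ)
  have hk2 := abs_nonneg (k.2 : ℝ)
  have hT1 : (0 : ℝ) < T + 1 := by positivity
  have hN0 : (0 : ℝ) ≤ ((M + M : ℕ) : ℝ) := Nat.cast_nonneg _
  by_cases hs : |k.1| < ((M + M : ℕ) : ℤ) ∧ |k.2| * 2 ^ T < ((M + M : ℕ) : ℤ)
  · have h := norm_expectVec_sq_le hφ (translation (M + M) k)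
      (fun r => if r = 0 then ((M + M : ℕ) : ℝ) else
        Real.sqrt ((M + M : ℕ) : ℝ) * correlationBound (M + M) T k r)
      (fun r => by
        have := correlationBound_nonneg (M + M) T k r
        split_ifs <;> positivity) T (fun r hr => by
        split_ifs with h0
        · rw [h0, evolve_zero]
          refine (norm_hsInner_le _ _).trans ?_
          rw [← hn]
          exact mul_le_mul hTn hTn (hsNorm_nonneg _) (Real.sqrt_nonneg _)
        · exact norm_hsInner_translation_evolve_le hk h0 hr hs.1 hs.2)
    refine h.trans ?_
    simp only [if_true, Nat.add_eq_zero_iff, one_ne_zero, and_false, if_false]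
    rw [← mul_sum]
    have hsum := sum_correlationBound_le hT k
    gcongr
    -- The constant is 201 = 1 + 2 · 100: the time-zero term plus twice the summed correlations.
    have h2 := mul_le_mul_of_nonneg_left hsum (Real.sqrt_nonneg ((M + M : ℕ) : ℝ))
    have h3 : Real.sqrt ((M + M : ℕ) : ℝ) * (100 * (1 + |(k.1 : ℝ)| + |(k.2 : ℝ)|) *
        Real.sqrt ((M + M : ℕ) : ℝ)) =
        100 * (1 + |(k.1 : ℝ)| + |(k.2 : ℝ)|) * ((M + M : ℕ) : ℝ) := by
      linear_combination (100 * (1 + |(k.1 : ℝ)| + |(k.2 : ℝ)|)) * hn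
    nlinarith
  -- For large k no decay is needed: |k₁| ≥ N or |k₂| ≥ N / 2^T ≥ 2^T makes the weight absorb T + 1.
  · have hTk : (T : ℝ) + 1 ≤ 1 + |(k.1 : ℝ)| + |(k.2 : ℝ)| := by
      have hT2 : T ≤ 2 ^ T := Nat.lt_two_pow_self.le
      have hN' : (2 : ℤ) ^ T * 2 ^ T ≤ ((M + M : ℕ) : ℤ) := by
        rw [← pow_add]
        have : 2 ^ (T + T) ≤ 2 ^ (40 * T) := Nat.pow_le_pow_right (by norm_num) (by omega)
        exact_mod_cast this.trans hT
      have hT3 : (T : ℤ) ≤ 2 ^ T := by exact_mod_cast hT2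
      have h1 : (1 : ℤ) ≤ 2 ^ T := one_le_pow₀ (by norm_num)
      rw [not_and_or, not_lt, not_lt] at hs
      have : (T : ℤ) ≤ |k.1| + |k.2| := by
        have a1 := abs_nonneg k.1
        have a2 := abs_nonneg k.2
        rcases hs with hs | hs
        · nlinarith
        · have : (2 : ℤ) ^ T ≤ |k.2| := le_of_mul_le_mul_right (hN'.trans hs) (by positivity)
          linarith
      have h2 : (T : ℝ) ≤ |(k.1 : ℝ)| + |(k.2 : ℝ)| := by exact_mod_cast this
      linarith
    have h1 : ‖expectVec φ (translation (M + M) k)‖ ^ 2 ≤ ((M + M : ℕ) : ℝ) := by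
      rw [← hn, ← sq]
      exact pow_le_pow_left₀ (norm_nonneg _) ((norm_expectVec_le φ _).trans hTn) 2
    refine h1.trans ?_
    rw [le_div_iff₀ hT1]
    nlinarith

end Variance

/-! ### Fourier coefficients of smooth observables. -/

section Fourier


open Set

lemma norm_torusMean_le {a : ℝ × ℝ → ℂ} {C : ℝ}
    (h : ∀ q ∈ Icc (0 : ℝ) 1, ∀ p ∈ Icc (0 : ℝ) 1, ‖a (q, p)‖ ≤ C) : ‖torusMean a‖ ≤ C := by
  have hsub : uIoc (0 : ℝ) 1 ⊆ Icc 0 1 := by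
    rw [uIoc_of_le zero_le_one]; exact Ioc_subset_Icc_self
  have h1 := intervalIntegral.norm_integral_le_of_norm_le_const (a := 0) (b := 1) (C := C)
    (f := fun q => ∫ p in (0 : ℝ)..1, a (q, p)) fun q hq => by
      have := intervalIntegral.norm_integral_le_of_norm_le_const (a := 0) (b := 1) (C := C)
        (f := fun p => a (q, p)) fun p hp => h q (hsub hq) p (hsub hp)
      simpa using this
  simpa [torusMean] using h1

/-- The conjugate plane wave `e^{-2πi (q k₂ - p k₁)}`. -/
def planeWave (k : ℤ × ℤ) (x : ℝ × ℝ) : ℂ :=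
  Complex.exp (-(2 * Real.pi * Complex.I * (x.1 * k.2 - x.2 * k.1)))

lemma norm_planeWave (k : ℤ × ℤ) (x : ℝ × ℝ) : ‖planeWave k x‖ = 1 := by
  have : (-(2 * Real.pi * Complex.I * (x.1 * k.2 - x.2 * k.1)) : ℂ) =
      ((-(2 * Real.pi * (x.1 * k.2 - x.2 * k.1)) : ℝ) : ℂ) * Complex.I := by
    push_cast; ring
  rw [planeWave, this, Complex.norm_exp_ofReal_mul_I]

lemma planeWave_periodic (k : ℤ × ℤ) (q : ℝ) : planeWave k (q, 1) = planeWave k (q, 0) := by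
  rw [planeWave, planeWave, Complex.exp_eq_exp_iff_exists_int]
  refine ⟨k.1, ?_⟩
  push_cast
  ring

lemma continuous_planeWave (k : ℤ × ℤ) : Continuous (planeWave k) := by
  unfold planeWave; fun_prop

lemma fourierCoefficient_eq (a : ℝ × ℝ → ℂ) (k : ℤ × ℤ) :
    fourierCoefficient a k = torusMean fun x => a x * planeWave k x := rfl

lemma IsSmoothObservable.exists_norm_fourierCoefficient_le {a : ℝ × ℝ → ℂ}
    (ha : IsSmoothObservable a) : ∃ C, ∀ k, ‖fourierCoefficient a k‖ ≤ C := by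
  obtain ⟨C, hC⟩ := ((isCompact_Icc (a := (0 : ℝ)) (b := 1)).prod
    (isCompact_Icc (a := (0 : ℝ)) (b := 1))).exists_bound_of_continuousOn
      ha.contDiff.continuous.continuousOn
  refine ⟨C, fun k => norm_torusMean_le fun q hq p hp => ?_⟩
  rw [norm_mul]
  change _ * ‖planeWave k (q, p)‖ ≤ C
  rw [norm_planeWave, mul_one]
  exact hC (q, p) ⟨hq, hp⟩

/-- The derivative in `p`. -/
def derivP (a : ℝ × ℝ → ℂ) (x : ℝ × ℝ) : ℂ := fderiv ℝ a x (0, 1)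

lemma IsSmoothObservable.derivP {a : ℝ × ℝ → ℂ} (ha : IsSmoothObservable a) :
    IsSmoothObservable (derivP a) := by
  have hper : ∀ v : ℝ × ℝ, (∀ x, a (x + v) = a x) → ∀ x, BakerMap.derivP a (x + v) =
      BakerMap.derivP a x := by
    intro v hv x
    have h1 : (fun x => a (x + v)) = a := funext hv
    rw [BakerMap.derivP, BakerMap.derivP, ← fderiv_comp_add_right, h1]
  refine ⟨?_, fun q p => ?_, fun q p => ?_⟩
  · have h1 : ContDiff ℝ ∞ (fderiv ℝ a) := ha.contDiff.fderiv_right (m := ∞) (by simp)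
    exact h1.clm_apply contDiff_const
  · have := hper (1, 0) (fun x => by
      obtain ⟨q, p⟩ := x
      simpa using ha.periodic_q q p) (q, p)
    simpa using this
  · have := hper (0, 1) (fun x => by
      obtain ⟨q, p⟩ := x
      simpa using ha.periodic_p q p) (q, p)
    simpa using this

/-- Integration by parts in p; periodicity removes the boundary terms. -/
lemma fourierCoefficient_derivP {a : ℝ × ℝ → ℂ} (ha : IsSmoothObservable a) (k : ℤ × ℤ) :
    fourierCoefficient (derivP a) k = -(2 * Real.pi * Complex.I * k.1) * fourierCoefficient a k := by
  have hline : ∀ q p : ℝ, HasDerivAt (fun p : ℝ => (q, p)) ((0, 1) : ℝ × ℝ) p := fun q p =>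
    (hasDerivAt_const p q).prodMk (hasDerivAt_id p)
  have hinner : ∀ q : ℝ, ∫ p in (0 : ℝ)..1, derivP a (q, p) * planeWave k (q, p) =
      -(2 * Real.pi * Complex.I * k.1) * ∫ p in (0 : ℝ)..1, a (q, p) * planeWave k (q, p) := by
    intro q
    have hu : ∀ p ∈ uIcc (0 : ℝ) 1, HasDerivAt (fun p => a (q, p)) (derivP a (q, p)) p := by
      intro p _
      have hd := (ha.contDiff.differentiable (by simp) (q, p)).hasFDerivAt
      exact hd.comp_hasDerivAt p (hline q p)
    have hv : ∀ p ∈ uIcc (0 : ℝ) 1, HasDerivAt (fun p => planeWave k (q, p))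
        (2 * Real.pi * Complex.I * k.1 * planeWave k (q, p)) p := by
      intro p _
      have h1 : HasDerivAt (fun p : ℝ => -(2 * Real.pi * Complex.I * (q * k.2 - (p : ℂ) * k.1)))
          (2 * Real.pi * Complex.I * k.1) p := by
        have h2 := ((((hasDerivAt_id (p : ℂ)).mul_const (k.1 : ℂ)).const_sub
          ((q : ℂ) * k.2)).const_mul (2 * Real.pi * Complex.I : ℂ)).neg.comp_ofReal
        refine h2.congr_deriv ?_
        ring
      exact h1.cexp.congr_deriv (mul_comm _ _)
    have hca := ha.derivP.contDiff.continuous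
    have hcw := continuous_planeWave k
    have hmk : Continuous fun p : ℝ => (q, p) := by fun_prop
    have cw : Continuous fun p : ℝ => planeWave k (q, p) := hcw.comp hmk
    have cw' : Continuous fun p : ℝ => 2 * Real.pi * Complex.I * k.1 * planeWave k (q, p) :=
      continuous_const.mul cw
    have ca' : Continuous fun p : ℝ => derivP a (q, p) := hca.comp hmk
    have i1 : Continuous fun p : ℝ => derivP a (q, p) * planeWave k (q, p) := ca'.mul cw
    have i2 : Continuous fun p : ℝ =>
        a (q, p) * (2 * Real.pi * Complex.I * k.1 * planeWave k (q, p)) :=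
      (ha.contDiff.continuous.comp hmk).mul cw'
    have := intervalIntegral.integral_deriv_mul_eq_sub hu hv (ca'.intervalIntegrable _ _)
      (cw'.intervalIntegrable _ _)
    have hper : a (q, 1) = a (q, 0) := by simpa using ha.periodic_p q 0
    rw [planeWave_periodic, hper, sub_self, intervalIntegral.integral_add
      (i1.intervalIntegrable _ _) (i2.intervalIntegrable _ _)] at this
    rw [eq_neg_of_add_eq_zero_left this, neg_mul, ← intervalIntegral.integral_const_mul]
    congr 1
    refine intervalIntegral.integral_congr fun p _ => ?_
    ring
  rw [fourierCoefficient_eq, fourierCoefficient_eq, torusMean, torusMean,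
    ← intervalIntegral.integral_const_mul]
  exact intervalIntegral.integral_congr fun q _ => hinner q

lemma IsSmoothObservable.swap {a : ℝ × ℝ → ℂ} (ha : IsSmoothObservable a) :
    IsSmoothObservable fun x => a x.swap :=
  ⟨ha.contDiff.comp (contDiff_snd.prodMk contDiff_fst), fun q p => ha.periodic_p p q,
    fun q p => ha.periodic_q p q⟩

/-- Fubini. It transfers the decay in k₁, obtained from p-derivatives, to decay in k₂. -/
lemma fourierCoefficient_swap {a : ℝ × ℝ → ℂ} (ha : Continuous a) (k : ℤ × ℤ) :
    fourierCoefficient (fun x => a x.swap) k = fourierCoefficient a (-k.2, -k.1) := by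
  rw [fourierCoefficient_eq, fourierCoefficient_eq, torusMean, torusMean]
  have hc : Continuous fun x : ℝ × ℝ => a x.swap * planeWave k x :=
    (ha.comp continuous_swap).mul (continuous_planeWave k)
  have hi : MeasureTheory.IntegrableOn
      (Function.uncurry fun q p => a (Prod.swap (q, p)) * planeWave k (q, p))
      (Set.Ioc 0 1 ×ˢ Set.Ioc 0 1) (MeasureTheory.volume.prod MeasureTheory.volume) :=
    (hc.continuousOn.integrableOn_compact (isCompact_Icc.prod isCompact_Icc)).mono_set
      (Set.prod_mono Set.Ioc_subset_Icc_self Set.Ioc_subset_Icc_self)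
  simp only [intervalIntegral.integral_of_le (zero_le_one (α := ℝ))]
  rw [MeasureTheory.integral_integral_swap]
  · refine MeasureTheory.integral_congr_ae (Filter.Eventually.of_forall fun q => ?_)
    refine MeasureTheory.integral_congr_ae (Filter.Eventually.of_forall fun p => ?_)
    simp only [Prod.swap_prod_mk, planeWave]
    congr 2
    push_cast
    ring
  · rwa [MeasureTheory.Measure.prod_restrict]

lemma IsSmoothObservable.exists_fourierCoefficient_fst {a : ℝ × ℝ → ℂ}
    (ha : IsSmoothObservable a) : ∃ b, IsSmoothObservable b ∧ ∀ k : ℤ × ℤ,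
      (k.1 : ℝ) ^ 2 * ‖fourierCoefficient a k‖ ≤ ‖fourierCoefficient b k‖ := by
  refine ⟨_, ha.derivP.derivP, fun k => ?_⟩
  rw [fourierCoefficient_derivP ha.derivP, fourierCoefficient_derivP ha, ← mul_assoc, norm_mul]
  gcongr
  simp only [norm_mul, norm_neg, Complex.norm_I, Complex.norm_real, Complex.norm_intCast,
    Complex.norm_ofNat, mul_one, Real.norm_of_nonneg Real.pi_pos.le]
  rw [← sq, mul_pow, sq_abs]
  refine le_mul_of_one_le_left (sq_nonneg _) (one_le_pow₀ ?_)
  linarith [Real.two_le_pi]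

lemma IsSmoothObservable.exists_fourierCoefficient_snd {a : ℝ × ℝ → ℂ}
    (ha : IsSmoothObservable a) : ∃ b, IsSmoothObservable b ∧ ∀ k : ℤ × ℤ,
      (k.2 : ℝ) ^ 2 * ‖fourierCoefficient a k‖ ≤ ‖fourierCoefficient b k‖ := by
  obtain ⟨b, hb, h⟩ := ha.swap.exists_fourierCoefficient_fst
  refine ⟨_, hb.swap, fun k => ?_⟩
  have := h (-k.2, -k.1)
  rw [fourierCoefficient_swap ha.contDiff.continuous] at this
  rw [fourierCoefficient_swap hb.contDiff.continuous]
  simpa using this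

/-- Rapid decay of the Fourier coefficients of a smooth observable. -/
lemma IsSmoothObservable.exists_decay {a : ℝ × ℝ → ℂ} (ha : IsSmoothObservable a) :
    ∃ C, ∀ k : ℤ × ℤ, (1 + (k.1 : ℝ) ^ 2) ^ 2 * (1 + (k.2 : ℝ) ^ 2) ^ 2 *
      ‖fourierCoefficient a k‖ ≤ C := by
  -- If multiplication by f is dominated by passing to another smooth observable, a weight w valid
  -- for all observables improves to (1 + f)w; four uses give the result.
  have step : ∀ f w : ℤ × ℤ → ℝ, (∀ k, 0 ≤ w k) → (∀ a, IsSmoothObservable a →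
      ∃ b, IsSmoothObservable b ∧ ∀ k, f k * ‖fourierCoefficient a k‖ ≤ ‖fourierCoefficient b k‖) →
      (∀ a, IsSmoothObservable a → ∃ C, ∀ k, w k * ‖fourierCoefficient a k‖ ≤ C) →
      ∀ a, IsSmoothObservable a → ∃ C, ∀ k, (1 + f k) * w k * ‖fourierCoefficient a k‖ ≤ C := by
    intro f w hw hf h a ha
    obtain ⟨b, hb, hab⟩ := hf a ha
    obtain ⟨C, hC⟩ := h a ha
    obtain ⟨D, hD⟩ := h b hb
    refine ⟨C + D, fun k => ?_⟩
    have h1 := mul_le_mul_of_nonneg_left (hab k) (hw k)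
    linarith [hC k, hD k]
  have h0 : ∀ a, IsSmoothObservable a → ∃ C, ∀ k : ℤ × ℤ, 1 * ‖fourierCoefficient a k‖ ≤ C := by
    intro a ha
    simpa using ha.exists_norm_fourierCoefficient_le
  have h1 := step (fun k => (k.2 : ℝ) ^ 2) _ (fun k => by positivity)
    (fun a ha => ha.exists_fourierCoefficient_snd) h0
  have h2 := step (fun k => (k.2 : ℝ) ^ 2) _ (fun k => by positivity)
    (fun a ha => ha.exists_fourierCoefficient_snd) h1
  have h3 := step (fun k => (k.1 : ℝ) ^ 2) _ (fun k => by positivity)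
    (fun a ha => ha.exists_fourierCoefficient_fst) h2
  obtain ⟨C, hC⟩ := step (fun k => (k.1 : ℝ) ^ 2) _ (fun k => by positivity)
    (fun a ha => ha.exists_fourierCoefficient_fst) h3 a ha
  refine ⟨C, fun k => le_of_eq_of_le ?_ (hC k)⟩
  ring

lemma summable_inv_one_add_sq : Summable fun m : ℤ => 1 / (1 + (m : ℝ) ^ 2) := by
  have h : Summable fun m : ℤ => 1 / (m : ℝ) ^ 2 := Real.summable_one_div_int_pow.2 (by norm_num)
  refine Summable.of_norm_bounded_eventually h ?_
  have : ∀ᶠ m : ℤ in Filter.cofinite, m ≠ 0 := (Set.finite_singleton (0 : ℤ)).eventually_cofinite_notMem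
  filter_upwards [this] with m hm
  have hm' : (0 : ℝ) < (m : ℝ) ^ 2 := by positivity
  rw [Real.norm_of_nonneg (by positivity)]
  gcongr
  linarith

/-- Of the squared decay weight, one factor absorbs 1 + |k₁| + |k₂| and the other is summable over
ℤ². -/
lemma IsSmoothObservable.summable_weighted {a : ℝ × ℝ → ℂ} (ha : IsSmoothObservable a) :
    Summable fun k : ℤ × ℤ => ‖fourierCoefficient a k‖ * (1 + |(k.1 : ℝ)| + |(k.2 : ℝ)|) := by
  obtain ⟨C, hC⟩ := ha.exists_decay
  have hs : Summable fun k : ℤ × ℤ =>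
      4 * C * (1 / (1 + (k.1 : ℝ) ^ 2) * (1 / (1 + (k.2 : ℝ) ^ 2))) :=
    (summable_inv_one_add_sq.mul_of_nonneg summable_inv_one_add_sq
      (fun m => by positivity) (fun m => by positivity)).mul_left _
  refine Summable.of_nonneg_of_le (fun k => by positivity) (fun k => ?_) hs
  set x := (k.1 : ℝ)
  set y := (k.2 : ℝ)
  have hx : 1 + |x| ≤ 2 * (1 + x ^ 2) := by
    nlinarith [sq_nonneg (|x| - 1), sq_abs x, abs_nonneg x]
  have hy : 1 + |y| ≤ 2 * (1 + y ^ 2) := by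
    nlinarith [sq_nonneg (|y| - 1), sq_abs y, abs_nonneg y]
  have hxy : 1 + |x| + |y| ≤ (2 * (1 + x ^ 2)) * (2 * (1 + y ^ 2)) := by
    calc 1 + |x| + |y| ≤ (1 + |x|) * (1 + |y|) := by nlinarith [abs_nonneg x, abs_nonneg y]
      _ ≤ _ := by gcongr
  calc ‖fourierCoefficient a k‖ * (1 + |x| + |y|)
      ≤ ‖fourierCoefficient a k‖ * ((2 * (1 + x ^ 2)) * (2 * (1 + y ^ 2))) := by gcongr
    _ = 4 * ((1 + x ^ 2) ^ 2 * (1 + y ^ 2) ^ 2 * ‖fourierCoefficient a k‖) *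
        (1 / (1 + x ^ 2) * (1 / (1 + y ^ 2))) := by
        have h1 : (1 + x ^ 2) ≠ 0 := by positivity
        have h2 : (1 + y ^ 2) ≠ 0 := by positivity
        field_simp
        norm_num
    _ ≤ _ := by
        gcongr
        exact hC k

end Fourier

/-! ### From translations to Weyl quantisations, and the choice of time scale. -/

lemma norm_translation_apply_le (N : ℕ) (k : ℤ × ℤ) (i j : Fin N) :
    ‖translation N k i j‖ ≤ 1 := by
  have hN : 0 < N := i.pos
  rw [translation_eq hN, diagonal_mul, norm_mul, sample, norm_mul, norm_weylPhase, norm_circ,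
    momentumOp_circ_apply hN]
  split_ifs <;> simp

lemma IsSmoothObservable.summable_weyl {a : ℝ × ℝ → ℂ} (ha : IsSmoothObservable a) (N : ℕ) :
    Summable fun k : ℤ × ℤ => fourierCoefficient a k • translation N k := by
  refine Pi.summable.2 fun i => Pi.summable.2 fun j => ?_
  refine Summable.of_norm_bounded ha.summable_weighted fun k => ?_
  rw [Matrix.smul_apply, smul_eq_mul, norm_mul]
  gcongr
  refine (norm_translation_apply_le N k i j).trans ?_
  have h1 := abs_nonneg (k.1 : ℝ)
  have h2 := abs_nonneg (k.2 : ℝ)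
  linarith

lemma translation_zero (N : ℕ) : translation N 0 = 1 := by
  ext i j
  rw [translation, Matrix.of_apply, Matrix.one_apply]
  have h : ((i : ℕ) : ℤ) ≡ ((j : ℕ) : ℤ) + (0 : ℤ × ℤ).1 [ZMOD (N : ℤ)] ↔ i = j := by
    rw [Prod.fst_zero, add_zero, Int.natCast_modEq_iff, Nat.ModEq, Nat.mod_eq_of_lt i.2,
      Nat.mod_eq_of_lt j.2, Fin.ext_iff]
  simp only [h]
  split_ifs <;> simp

lemma fourierCoefficient_zero (a : ℝ × ℝ → ℂ) : fourierCoefficient a 0 = torusMean a := by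
  simp [fourierCoefficient]

lemma quantumVariance_eq {N : ℕ} (φ : OrthonormalBasis (Fin N) ℂ (StateSpace N))
    (a : ℝ × ℝ → ℂ) : quantumVariance φ a =
      1 / N * ‖expectVec φ (weyl N a) - torusMean a • expectVec φ 1‖ ^ 2 := by
  rw [quantumVariance, EuclideanSpace.norm_sq_eq]
  congr 1
  refine Finset.sum_congr rfl fun j _ => ?_
  have h : (inner ℂ (φ j) (op 1 (φ j)) : ℂ) = 1 := by
    rw [op, Matrix.toLpLin_one, LinearMap.id_apply, inner_self_eq_norm_sq_to_K, φ.norm_eq_one]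
    simp
  change _ = ‖inner ℂ (φ j) (op (weyl N a) (φ j)) -
    torusMean a • inner ℂ (φ j) (op 1 (φ j))‖ ^ 2
  rw [h, smul_eq_mul, mul_one]

/-- The quantum variance is controlled by that of the quantum translations. -/
lemma norm_expectVec_weyl_sub_le {N : ℕ} (φ : OrthonormalBasis (Fin N) ℂ (StateSpace N))
    {a : ℝ × ℝ → ℂ} (ha : IsSmoothObservable a) {R : ℝ}
    (hR : ∀ k : ℤ × ℤ, k ≠ 0 →
      ‖expectVec φ (translation N k)‖ ≤ R * (1 + |(k.1 : ℝ)| + |(k.2 : ℝ)|)) (hR0 : 0 ≤ R) :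
    ‖expectVec φ (weyl N a) - torusMean a • expectVec φ 1‖ ≤
      R * ∑' k : ℤ × ℤ, ‖fourierCoefficient a k‖ * (1 + |(k.1 : ℝ)| + |(k.2 : ℝ)|) := by
  have hcont : Continuous (expectVec φ) := LinearMap.continuous_of_finiteDimensional _
  have hsum := (ha.summable_weyl N).hasSum.map (expectVec φ) hcont
  change HasSum _ (expectVec φ (weyl N a)) at hsum
  -- The mean is the term k = 0, because T(0) = 1; subtracting it leaves only k ≠ 0.
  have h1 := hsum.sub (hasSum_ite_eq (0 : ℤ × ℤ) (torusMean a • expectVec φ 1))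
  refine h1.norm_le_of_bounded (ha.summable_weighted.hasSum.mul_left R) fun k => ?_
  by_cases hk : k = 0
  · subst hk
    simp only [Function.comp_apply, map_smul, fourierCoefficient_zero, translation_zero, if_true,
      sub_self, norm_zero]
    positivity
  · simp only [Function.comp_apply, map_smul, hk, if_false, sub_zero, norm_smul]
    calc ‖fourierCoefficient a k‖ * ‖expectVec φ (translation N k)‖
        ≤ ‖fourierCoefficient a k‖ * (R * (1 + |(k.1 : ℝ)| + |(k.2 : ℝ)|)) := by
          gcongr
          exact hR k hk
      _ = _ := by ring

/-- The logarithmic time scale. -/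
lemma exists_log_time {N : ℕ} (hN : 0 < N) :
    ∃ T : ℕ, 2 ^ (40 * T) ≤ N ∧ Real.log N ≤ 40 * (T + 1) := by
  obtain ⟨L, hL, hL'⟩ : ∃ L, 2 ^ L ≤ N ∧ N < 2 ^ (L + 1) :=
    ⟨Nat.log 2 N, Nat.pow_log_le_self 2 hN.ne', Nat.lt_pow_succ_log_self one_lt_two N⟩
  obtain ⟨T, h40, h41⟩ : ∃ T, 40 * T ≤ L ∧ L + 1 ≤ 40 * (T + 1) :=
    ⟨L / 40, by omega, by omega⟩
  refine ⟨T, (Nat.pow_le_pow_right two_pos h40).trans hL, ?_⟩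
  obtain ⟨K, hK, hNK⟩ : ∃ K : ℕ, K = 40 * (T + 1) ∧ (N : ℝ) ≤ 2 ^ K := by
    obtain ⟨K, hK⟩ : ∃ K : ℕ, K = 40 * (T + 1) := ⟨_, rfl⟩
    refine ⟨K, hK, ?_⟩
    have h := hL'.le.trans (Nat.pow_le_pow_right two_pos (h41.trans hK.ge))
    exact_mod_cast h
  have h3 := Real.log_le_log (Nat.cast_pos.2 hN) hNK
  rw [Real.log_pow, hK] at h3
  push_cast at h3
  exact h3.trans (mul_le_of_le_one_right (by positivity) (by linarith [Real.log_two_lt_d9]))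

end BakerMap

end

theorem theorem1 (a : ℝ × ℝ → ℂ) (ha : BakerMap.IsSmoothObservable a) :
    (∀ N : ℕ, Summable fun k : ℤ × ℤ =>
      BakerMap.fourierCoefficient a k • BakerMap.translation N k) ∧
    ∃ C : ℝ, ∀ N : ℕ, 0 < N → Even N →
      ∀ φ : OrthonormalBasis (Fin N) ℂ (BakerMap.StateSpace N),
        BakerMap.IsBakerEigenbasis φ →
          BakerMap.quantumVariance φ a ≤ C / Real.log N := by
  -- The 201 comes from the variance of one translation and the 40 from log N ≤ 40 (T + 1); the
  -- weighted sum is squared because expectation vectors are added in norm.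
  refine ⟨ha.summable_weyl, 40 * (201 * (∑' k : ℤ × ℤ, ‖BakerMap.fourierCoefficient a k‖ *
    (1 + |(k.1 : ℝ)| + |(k.2 : ℝ)|)) ^ 2), ?_⟩
  rintro N hN ⟨M, rfl⟩ φ hφ
  have : NeZero M := ⟨by omega⟩
  obtain ⟨T, hT, hlog⟩ := BakerMap.exists_log_time hN
  set S := ∑' k : ℤ × ℤ, ‖BakerMap.fourierCoefficient a k‖ * (1 + |(k.1 : ℝ)| + |(k.2 : ℝ)|)
  have hNr : (0 : ℝ) < ((M + M : ℕ) : ℝ) := by exact_mod_cast hN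
  set R := Real.sqrt (201 * ((M + M : ℕ) : ℝ) / (T + 1)) with hR
  have hR2 : R ^ 2 = 201 * ((M + M : ℕ) : ℝ) / (T + 1) := Real.sq_sqrt (by positivity)
  have hR0 : 0 ≤ R := Real.sqrt_nonneg _
  have h := BakerMap.norm_expectVec_weyl_sub_le φ ha (R := R) (fun k hk => by
    have hw : 1 ≤ 1 + |(k.1 : ℝ)| + |(k.2 : ℝ)| := by
      linarith [abs_nonneg (k.1 : ℝ), abs_nonneg (k.2 : ℝ)]
    refine (sq_le_sq₀ (norm_nonneg _) (by positivity)).1 ?_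
    refine (BakerMap.norm_expectVec_translation_sq_le hφ hT hk).trans ?_
    rw [mul_pow, hR2]
    calc _ = 201 * ((M + M : ℕ) : ℝ) / (T + 1) * (1 + |(k.1 : ℝ)| + |(k.2 : ℝ)|) := by ring
      _ ≤ _ := by
        gcongr
        exact le_self_pow₀ hw (by norm_num)) hR0
  have h2 := pow_le_pow_left₀ (norm_nonneg _) h 2
  rw [mul_pow, hR2] at h2
  have hlog0 : 0 < Real.log ((M + M : ℕ) : ℝ) :=
    Real.log_pos (by exact_mod_cast (by omega : 1 < M + M))
  rw [BakerMap.quantumVariance_eq]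
  calc _ ≤ 1 / ((M + M : ℕ) : ℝ) * (201 * ((M + M : ℕ) : ℝ) / (T + 1) * S ^ 2) := by gcongr
    _ = 201 * S ^ 2 / (T + 1) := by field_simp
    _ ≤ _ := by
      rw [div_le_div_iff₀ (by positivity) hlog0]
      have h0 : 0 ≤ 201 * S ^ 2 := by positivity
      nlinarith
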